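/- **Setting.** Let $D,K,V\ge 1$ and $n_1,\dots,n_D\ge 1$ be integers and put $n=\sum_{d=1}^D n_d$. Let $\alpha\in(0,\infty)^K$, and let $\eta=(\eta_{\ell,r})$ be a $K\times V$ matrix with nonnegative entries whose rows sum to $1$. In latent Dirichlet allocation (LDA) the topic proportions $\pi_1,\dots,\pi_D$ are i.i.d. $\mathrm{Dir}(\alpha_1,\dots,\alpha_K)$; given these, the topics $Z_{d,i}\in[K]$ ($d\in[D]$, $i\in[n_d]$) are independent with $Z_{d,i}\sim\mathrm{Cat}(\pi_d)$; given these, the words $X_{d,i}\in[V]$ are independent with $X_{d,i}\sim\mathrm{Cat}(\eta_{Z_{d,i},\cdot})$. For fixed data $\mathbf X=(X_{d,i})\in[V]^n$, let $\mathbb P(\mathbf Z,\{\pi_d\}\mid\mathbf X)$ be the posterior (the normalized product of prior density and likelihood), and let $\mathbb P(\mathbf Z\mid\mathbf X)$ be its marginal on $\mathbf Z$, the collapsed posterior. Let $\mathcal P$ be the set of probability measures on $(\{\pi_d\},\mathbf Z)$ whose density with respect to (Lebesgue measure on the simplex)$^{\otimes D}\,\otimes$ (counting measure on $[K]$)$^{\otimes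 n}$ has the product form $\prod_d\xi_d(\pi_d)\prod_{d,i}\zeta_{d,i}(Z_{d,i})$ with each factor a probability density, and let $\mathcal Q$ be the set of product probability measures on $[K]^n$. The variational posteriors are minimizers of the Kullback–Leibler divergence $$\hat P\in\arg\min_{P\in\mathcal P}\mathrm D_{\mathrm{KL}}\big(P\,\|\,\mathbb P(\mathbf Z,\{\pi_d\}\mid\mathbf X)\big),\qquad \hat Q\in\arg\min_{Q\in\mathcal Q}\mathrm D_{\mathrm{KL}}\big(Q\,\|\,\mathbb P(\mathbf Z\mid\mathbf X)\big).$$ **Theorem 1.1.** Fix $C_0>0$. Consider LDA models such that for each $r\in[V]$ there is $\ell\in[K]$ with $\eta_{\ell,r}>0$, and such that $\alpha_\ell\in(0,C_0]$ for every $\ell\in[K]$. Then for every such model and every $\mathbf X\in[V]^n$, minimizers $\hat P$ and $\hat Q$ exist. There is a constant $C>0$ depending only on $C_0$ such that, for every such model and every choice of minimizers for each $\mathbf X$: (a) $$\frac1n\sup_{\mathbf X\in[V]^n}\mathrm D_{\mathrm{KL}}\big(\hat P\,\|\,\mathbb P(\mathbf Z,\{\pi_d\}\mid\mathbf X)\big)\le\frac{CDK}{n}\log\Big(\frac{n}{DK}+2\Big);$$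 (b) $$\frac1n\sup_{\mathbf X\in[V]^n}\mathrm D_{\mathrm{KL}}\big(\hat Q\,\|\,\mathbb P(\mathbf Z\mid\mathbf X)\big)\le\frac{CDK}{n}\log\Big(\frac{n}{DK}+2\Big).$$ Consequently, along every sequence of such models (with the same $C_0$) with $DK/n\to0$, the left-hand sides of (a) and (b) converge to $0$. -/

import Mathlib

open MeasureTheory Filter Topology
open scoped ENNReal

/-- The point of the probability simplex in `ℝ^K` whose first `K - 1` coordinates are `x` and whose
last coordinate is `1 - ∑ x`. -/
noncomputable def simplexPoint (K : ℕ) (x : Fin (K - 1) → ℝ) : Fin K → ℝ :=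
  fun ℓ => if h : ℓ.val < K - 1 then x ⟨ℓ.val, h⟩ else 1 - ∑ j, x j

theorem measurable_simplexPoint (K : ℕ) : Measurable (simplexPoint K) := by
  refine measurable_pi_lambda _ fun ℓ => ?_
  by_cases h : ℓ.val < K - 1
  · simp only [simplexPoint, h, dite_true]
    fun_prop
  · simp only [simplexPoint, h, dite_false]
    fun_prop

/-- Lebesgue measure `dπ_1 ⋯ dπ_{K-1}` on the probability simplex
`{π ∈ ℝ^K : π_ℓ ≥ 0, ∑ π_ℓ = 1}`, as a measure on `ℝ^K`.
For `K = 1` this is the unit mass at the point `1`. -/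
noncomputable def simplexVolume (K : ℕ) : Measure (Fin K → ℝ) :=
  ((volume : Measure (Fin (K - 1) → ℝ)).restrict {x | (∀ j, 0 ≤ x j) ∧ ∑ j, x j ≤ 1}).map
    (simplexPoint K)

/-- The density of the Dirichlet distribution `Dir(α_1, …, α_K)` with respect to
`simplexVolume K`. -/
noncomputable def dirichletPDF {K : ℕ} (α : Fin K → ℝ) (π : Fin K → ℝ) : ℝ≥0∞ :=
  ENNReal.ofReal
    (Real.Gamma (∑ ℓ, α ℓ) / (∏ ℓ, Real.Gamma (α ℓ)) * ∏ ℓ, π ℓ ^ (α ℓ - 1))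

/-- The dimensions and the hyperparameters of a latent Dirichlet allocation model. -/
structure LDAModel where
  /-- the number of documents -/
  D : ℕ
  /-- the number of latent topics -/
  K : ℕ
  /-- the size of the vocabulary -/
  V : ℕ
  /-- the number of words of each document -/
  len : Fin D → ℕ
  /-- the parameters of the Dirichlet prior -/
  α : Fin K → ℝ
  /-- `η ℓ r` is the probability of the vocabulary word `r` under topic `ℓ` -/
  η : Fin K → Fin V → ℝ
  D_pos : 0 < D
  K_pos : 0 < K
  V_pos : 0 < V
  len_pos : ∀ d, 0 < len d
  α_pos : ∀ ℓ, 0 < α ℓ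
  η_nonneg : ∀ ℓ r, 0 ≤ η ℓ r
  η_sum : ∀ ℓ, ∑ r, η ℓ r = 1

namespace LDAModel

/-- The total number `n` of words. -/
def n (M : LDAModel) : ℕ := ∑ d, M.len d

/-- The space of data `X = (X_{d,i})`. -/
abbrev Data (M : LDAModel) : Type := (d : Fin M.D) → Fin (M.len d) → Fin M.V

/-- The space of local latent variables `Z = (Z_{d,i})`. -/
abbrev Topics (M : LDAModel) : Type := (d : Fin M.D) → Fin (M.len d) → Fin M.K

/-- The space of global latent variables `(π_d)`. -/
abbrev Proportions (M : LDAModel) : Type := Fin M.D → Fin M.K → ℝ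

/-- The product base measure on the latent variables `((π_d), Z)`: Lebesgue measure on the simplex
for each `π_d`, and counting measure for each `Z_{d,i}` (the product of the counting measures on
the coordinates is the counting measure on the finite space `M.Topics`). -/
noncomputable def baseMeasure (M : LDAModel) : Measure (M.Proportions × M.Topics) :=
  (Measure.pi fun _ : Fin M.D => simplexVolume M.K).prod (Measure.count : Measure M.Topics)

/-- The prior density of `((π_d), Z)` with respect to the base measure: the `π_d` are independent
with law `Dir(α)` and, given `(π_d)`, the `Z_{d,i}` are independent with laws `Cat(π_d)`. -/
noncomputable def priorDensity (M : LDAModel) (p : M.Proportions × M.Topics) : ℝ≥0∞ :=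
  (∏ d, dirichletPDF M.α (p.1 d)) * ∏ d, ∏ i, ENNReal.ofReal (p.1 d (p.2 d i))

/-- The likelihood of the data `X`: given `((π_d), Z)`, the words `X_{d,i}` are independent, and
`X_{d,i}` has law `Cat(η_ℓ)` with `ℓ = Z_{d,i}`. -/
noncomputable def likelihood (M : LDAModel) (X : M.Data) (p : M.Proportions × M.Topics) : ℝ≥0∞ :=
  ∏ d, ∏ i, ENNReal.ofReal (M.η (p.2 d i) (X d i))

/-- The evidence, that is, the normalizing constant of the posterior. -/
noncomputable def evidence (M : LDAModel) (X : M.Data) : ℝ≥0∞ :=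
  ∫⁻ p, M.priorDensity p * M.likelihood X p ∂M.baseMeasure

/-- The full posterior distribution of `((π_d), Z)` given `X`. -/
noncomputable def posterior (M : LDAModel) (X : M.Data) : Measure (M.Proportions × M.Topics) :=
  M.baseMeasure.withDensity fun p => M.priorDensity p * M.likelihood X p / M.evidence X

/-- The collapsed posterior: the marginal law of `Z` under the full posterior. -/
noncomputable def collapsedPosterior (M : LDAModel) (X : M.Data) : Measure M.Topics :=
  (M.posterior X).map Prod.snd

/-- The mean-field family on `((π_d), Z)`: the probability measures whose density with respect to
the base measure is a product of a density in each `π_d` and a density in each `Z_{d,i}`. -/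
def fullMeanField (M : LDAModel) : Set (Measure (M.Proportions × M.Topics)) :=
  {P | ∃ (ξ : Fin M.D → (Fin M.K → ℝ) → ℝ≥0∞)
      (ζ : (d : Fin M.D) → Fin (M.len d) → Fin M.K → ℝ≥0∞),
    (∀ d, Measurable (ξ d) ∧ ∫⁻ x, ξ d x ∂simplexVolume M.K = 1) ∧
    (∀ d i, ∑ ℓ, ζ d i ℓ = 1) ∧
    P = M.baseMeasure.withDensity fun p =>
      (∏ d, ξ d (p.1 d)) * ∏ d, ∏ i, ζ d i (p.2 d i)}

/-- The mean-field family on `Z`: the product probability measures. -/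
def collapsedMeanField (M : LDAModel) : Set (Measure M.Topics) :=
  {Q | ∃ ζ : (d : Fin M.D) → Fin (M.len d) → Fin M.K → ℝ≥0∞,
    (∀ d i, ∑ ℓ, ζ d i ℓ = 1) ∧
    Q = (Measure.count : Measure M.Topics).withDensity fun z => ∏ d, ∏ i, ζ d i (z d i)}

/-- `P` is a (full) variational posterior: a minimizer over the mean-field family of the
Kullback–Leibler divergence to the posterior. -/
def IsFullVP (M : LDAModel) (X : M.Data) (P : Measure (M.Proportions × M.Topics)) : Prop :=
  P ∈ M.fullMeanField ∧
    IsMinOn (fun P' => InformationTheory.klDiv P' (M.posterior X)) M.fullMeanField P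

/-- `Q` is a collapsed variational posterior: a minimizer over the mean-field family of the
Kullback–Leibler divergence to the collapsed posterior. -/
def IsCollapsedVP (M : LDAModel) (X : M.Data) (Q : Measure M.Topics) : Prop :=
  Q ∈ M.collapsedMeanField ∧
    IsMinOn (fun Q' => InformationTheory.klDiv Q' (M.collapsedPosterior X))
      M.collapsedMeanField Q

/-- Every vocabulary word has positive probability under at least one topic, and all the
`α_ℓ` are at most `C₀`. -/
def Admissible (M : LDAModel) (C₀ : ℝ) : Prop :=
  (∀ r, ∃ ℓ, 0 < M.η ℓ r) ∧ ∀ ℓ, M.α ℓ ≤ C₀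

/-- The rate `(D K / n) log (n / (D K) + 2)`. -/
noncomputable def rate (M : LDAModel) : ℝ :=
  (M.D * M.K : ℝ) / M.n * Real.log ((M.n : ℝ) / (M.D * M.K) + 2)

end LDAModel

open InformationTheory

/-! Integrating out the proportions shows that the collapsed posterior of `z` is proportional to
`h(z) W(count z)`, where `h` is the product of the word likelihoods and `W` (`partition`) is a
Dirichlet moment. The dependence between topics thus enters only through the table of counts, and
few tables occur: their number has logarithm at most `3 D K log (n / (D K) + 2)`, by a generating
function bound (`card_countSet_mul_le`, `log_card_countSet_le`).

By pigeonhole some table `c` carries posterior mass at least one over the number of tables.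
Condition `h` on `count z = c` and take the product of the one-word marginals. Its expected counts
are exactly `c`, and by subadditivity of entropy its divergence from `h` is no larger than that of
the conditioned law, which is minus the logarithm of the `h`-mass of the fibre
(`exists_feasible_of_count`).

For fixed topic weights, Gibbs' variational principle gives the best law of the proportions: the
prior tilted by `∏ π ^ N`, with `N` the expected counts. The resulting minimum is `profile`
(`profile_le_klDiv`, `klDiv_optDensity`). At the weights above it is at most minus the logarithm of
the posterior mass of the fibre of `c`, hence at most the logarithm of the number of tables
(`exists_profile_le`). This proves (a). For (b), the topic marginal of a full minimizer is a
competitor, and divergence decreases under marginalization.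

Minimizers exist because both problems reduce to minimizing a continuous function over a compact set
of weights, the divergence being infinite for all other weights. -/

/-! ### Product integrals and integrability of Dirichlet weights on the simplex. -/

theorem lintegral_pi_prod {m : ℕ} {E : Fin m → Type*} [∀ i, MeasurableSpace (E i)]
    (μ : ∀ i, Measure (E i)) [∀ i, SigmaFinite (μ i)] (f : ∀ i, E i → ℝ≥0∞)
    (hf : ∀ i, Measurable (f i)) :
    ∫⁻ x, ∏ i, f i (x i) ∂Measure.pi μ = ∏ i, ∫⁻ x, f i x ∂μ i := by
  induction m with
  | zero => simp
  | succ m ih =>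
    rw [← ((measurePreserving_piFinSuccAbove μ 0).symm).lintegral_comp_emb
      (MeasurableEquiv.measurableEmbedding _)]
    simp_rw [Fin.prod_univ_succ]
    have hm : Measurable fun y : (i : Fin m) → E i.succ => ∏ i, f i.succ (y i) :=
      Finset.measurable_prod _ fun i _ => (hf _).comp (measurable_pi_apply i)
    rw [← ih (fun i => μ i.succ) (fun i => f i.succ) (fun i => hf _)]
    exact lintegral_prod_mul (μ := μ 0) (ν := Measure.pi fun i => μ i.succ) (hf 0).aemeasurable
      hm.aemeasurable

/-- Integrating a product of functions of all the coordinates but the `j`-th and of a function of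
`1 - ∑ x`. -/
theorem lintegral_prod_mul_one_sub_sum {m : ℕ} (j : Fin (m + 1)) (g : Fin m → ℝ → ℝ≥0∞)
    (hg : ∀ i, Measurable (g i)) (ψ : ℝ → ℝ≥0∞) (hψ : Measurable ψ) :
    ∫⁻ x : Fin (m + 1) → ℝ, (∏ i, g i (x (j.succAbove i))) * ψ (1 - ∑ i, x i)
      = (∏ i, ∫⁻ t, g i t) * ∫⁻ t, ψ t := by
  have hG : Measurable fun y : Fin m → ℝ => ∏ i, g i (y i) :=
    Finset.measurable_prod _ fun i _ => (hg _).comp (measurable_pi_apply i)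
  rw [← ((volume_preserving_piFinSuccAbove (fun _ : Fin (m + 1) => ℝ) j).symm).lintegral_comp_emb
      (MeasurableEquiv.measurableEmbedding _)]
  have h1 : ∀ p : ℝ × (Fin m → ℝ),
      (∏ i, g i ((MeasurableEquiv.piFinSuccAbove (fun _ : Fin (m + 1) => ℝ) j).symm p
        (j.succAbove i)))
      * ψ (1 - ∑ i, (MeasurableEquiv.piFinSuccAbove (fun _ : Fin (m + 1) => ℝ) j).symm p i)
      = (∏ i, g i (p.2 i)) * ψ ((1 - ∑ i, p.2 i) - p.1) := by
    intro p
    have e1 : (MeasurableEquiv.piFinSuccAbove (fun _ : Fin (m + 1) => ℝ) j).symm p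
        = j.insertNth p.1 p.2 := rfl
    rw [Fin.sum_univ_succAbove _ j, e1]
    simp [sub_sub, add_comm]
  simp_rw [h1]
  rw [Measure.volume_eq_prod, lintegral_prod_symm _ (by fun_prop)]
  have h2 : ∀ y : Fin m → ℝ, ∫⁻ t : ℝ, (∏ i, g i (y i)) * ψ ((1 - ∑ i, y i) - t)
      = (∏ i, g i (y i)) * ∫⁻ t, ψ t := by
    intro y
    rw [lintegral_const_mul _ (by fun_prop), lintegral_sub_left_eq_self ψ]
  simp_rw [h2]
  rw [lintegral_mul_const _ hG, volume_pi, lintegral_pi_prod _ _ hg]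

theorem simplexPoint_castSucc {m : ℕ} (x : Fin m → ℝ) (j : Fin m) :
    simplexPoint (m + 1) x j.castSucc = x j := by
  simp [simplexPoint]

theorem simplexPoint_last {m : ℕ} (x : Fin m → ℝ) :
    simplexPoint (m + 1) x (Fin.last m) = 1 - ∑ i, x i := by
  simp [simplexPoint]

/-- The density `t ^ (a - 1)` on `[0, 1]`. -/
noncomputable def unitPow (a t : ℝ) : ℝ≥0∞ :=
  (Set.Icc 0 1).indicator (fun t => ENNReal.ofReal (t ^ (a - 1))) t

theorem measurable_unitPow (a : ℝ) : Measurable (unitPow a) :=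
  Measurable.indicator (by fun_prop) measurableSet_Icc

theorem lintegral_unitPow_lt_top {a : ℝ} (ha : 0 < a) : ∫⁻ t, unitPow a t < ∞ := by
  unfold unitPow
  rw [lintegral_indicator measurableSet_Icc]
  have h := (intervalIntegral.intervalIntegrable_rpow' (a := 0) (b := 1)
    (r := a - 1) (by linarith))
  rw [intervalIntegrable_iff_integrableOn_Icc_of_le zero_le_one] at h
  exact h.lintegral_lt_top

/-- Any `m` of the `m + 1` barycentric coordinates are free coordinates of the chart. If the omitted
one is not the last, a translation in that variable turns `1 - ∑ x` into an independent coordinate.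
The cutoff in `unitPow` allows integration over the whole space. -/
theorem lintegral_prod_unitPow_simplexPoint_lt_top {m : ℕ} {α : Fin (m + 1) → ℝ}
    (hα : ∀ ℓ, 0 < α ℓ) (k : Fin (m + 1)) :
    ∫⁻ x : Fin m → ℝ, ∏ j, unitPow (α (k.succAbove j))
      (simplexPoint (m + 1) x (k.succAbove j)) < ∞ := by
  induction k using Fin.lastCases with
  | last =>
    simp only [Fin.succAbove_last, simplexPoint_castSucc]
    rw [volume_pi, lintegral_pi_prod _ (fun i => unitPow (α i.castSucc))
      (fun i => measurable_unitPow _)]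
    exact ENNReal.prod_lt_top fun i _ => lintegral_unitPow_lt_top (hα _)
  | cast j =>
    obtain _ | m := m
    · exact j.elim0
    have hlast : j.castSucc.succAbove (Fin.last m) = Fin.last (m + 1) := by
      rw [Fin.succAbove_castSucc_of_le _ _ (Fin.le_last j), Fin.succ_last]
    simp only [Fin.prod_univ_castSucc, Fin.castSucc_succAbove_castSucc, hlast,
      simplexPoint_castSucc, simplexPoint_last]
    rw [lintegral_prod_mul_one_sub_sum j
      (fun i => unitPow (α (j.succAbove i).castSucc)) (fun i => measurable_unitPow _) _
      (measurable_unitPow _)]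
    exact ENNReal.mul_lt_top (ENNReal.prod_lt_top fun i _ => lintegral_unitPow_lt_top (hα _))
      (lintegral_unitPow_lt_top (hα _))

theorem ofReal_rpow_le_of_inv_le {m : ℕ} {a t : ℝ} (ht : ((m : ℝ) + 1)⁻¹ ≤ t) (ht1 : t ≤ 1) :
    ENNReal.ofReal (t ^ (a - 1)) ≤ ENNReal.ofReal (max 1 ((((m : ℝ) + 1)⁻¹) ^ (a - 1))) := by
  have hm : 0 < ((m : ℝ) + 1)⁻¹ := by positivity
  refine ENNReal.ofReal_le_ofReal ?_
  rcases le_total 1 a with ha | ha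
  · exact le_max_of_le_left (Real.rpow_le_one (hm.le.trans ht) ht1 (by linarith))
  · exact le_max_of_le_right (Real.rpow_le_rpow_of_nonpos hm ht (by linarith))

/-- Some coordinate is at least `1 / (m + 1)`, so its factor is bounded and only `m` possibly
singular factors remain. Summing over the position of that coordinate covers all cases. -/
theorem prod_rpow_le_sum_unitPow {m : ℕ} (α π : Fin (m + 1) → ℝ) (h0 : ∀ ℓ, 0 ≤ π ℓ)
    (h1 : ∑ ℓ, π ℓ = 1) :
    ∏ ℓ, ENNReal.ofReal (π ℓ ^ (α ℓ - 1)) ≤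
      ∑ k, ENNReal.ofReal (max 1 ((((m : ℝ) + 1)⁻¹) ^ (α k - 1))) *
        ∏ j, unitPow (α (k.succAbove j)) (π (k.succAbove j)) := by
  have hle : ∀ ℓ, π ℓ ≤ 1 := fun ℓ =>
    h1 ▸ Finset.single_le_sum (fun i _ => h0 i) (Finset.mem_univ ℓ)
  obtain ⟨k, hk⟩ : ∃ k, ((m : ℝ) + 1)⁻¹ ≤ π k := by
    by_contra! h
    have := Finset.sum_lt_sum_of_nonempty Finset.univ_nonempty fun k _ => h k
    rw [h1] at this
    simp at this
    rw [mul_inv_cancel₀ (by positivity)] at this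
    exact lt_irrefl _ this
  refine le_trans ?_ (Finset.single_le_sum (f := fun k =>
    ENNReal.ofReal (max 1 ((((m : ℝ) + 1)⁻¹) ^ (α k - 1))) *
        ∏ j, unitPow (α (k.succAbove j)) (π (k.succAbove j))) (fun _ _ => zero_le)
        (Finset.mem_univ k))
  rw [Fin.prod_univ_succAbove _ k]
  refine mul_le_mul' (ofReal_rpow_le_of_inv_le hk (hle k)) (le_of_eq ?_)
  refine Finset.prod_congr rfl fun j _ => ?_
  rw [unitPow, Set.indicator_of_mem (Set.mem_Icc.2 ⟨h0 _, hle _⟩)]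

theorem sum_simplexPoint {m : ℕ} (x : Fin m → ℝ) : ∑ ℓ, simplexPoint (m + 1) x ℓ = 1 := by
  simp [Fin.sum_univ_castSucc, simplexPoint_castSucc, simplexPoint_last]

theorem ae_simplexVolume_of_forall {m : ℕ} {p : (Fin (m + 1) → ℝ) → Prop}
    (hp : MeasurableSet {x | p x}) (h : ∀ x, (∀ ℓ, 0 ≤ x ℓ) → ∑ ℓ, x ℓ = 1 → p x) :
    ∀ᵐ x ∂simplexVolume (m + 1), p x := by
  rw [simplexVolume, ae_map_iff (measurable_simplexPoint _).aemeasurable hp]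
  have hR : MeasurableSet {x : Fin m → ℝ | (∀ j, 0 ≤ x j) ∧ ∑ j, x j ≤ 1} := by measurability
  refine (ae_restrict_iff' hR).2 (ae_of_all _ fun x hx => h _ (fun ℓ => ?_) (sum_simplexPoint x))
  induction ℓ using Fin.lastCases with
  | last => rw [simplexPoint_last]; linarith [hx.2]
  | cast j => rw [simplexPoint_castSucc]; exact hx.1 j

theorem lintegral_prod_rpow_simplexVolume_lt_top {m : ℕ} {α : Fin (m + 1) → ℝ}
    (hα : ∀ ℓ, 0 < α ℓ) :
    ∫⁻ π, ∏ ℓ, ENNReal.ofReal (π ℓ ^ (α ℓ - 1)) ∂simplexVolume (m + 1) < ∞ := by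
  have hmeas : Measurable fun π : Fin (m + 1) → ℝ =>
      ∑ k, ENNReal.ofReal (max 1 ((((m : ℝ) + 1)⁻¹) ^ (α k - 1))) *
        ∏ j, unitPow (α (k.succAbove j)) (π (k.succAbove j)) := by
    refine Finset.measurable_sum _ fun k _ => Measurable.const_mul ?_ _
    exact Finset.measurable_prod _ fun j _ => (measurable_unitPow _).comp (measurable_pi_apply _)
  refine (lintegral_mono_ae (ae_simplexVolume_of_forall ?_
    fun x h0 h1 => prod_rpow_le_sum_unitPow α x h0 h1)).trans_lt ?_
  · exact measurableSet_le (by fun_prop) hmeas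
  rw [simplexVolume, lintegral_map hmeas (measurable_simplexPoint _)]
  refine (lintegral_mono' Measure.restrict_le_self le_rfl).trans_lt ?_
  have hm' : ∀ k : Fin (m + 1), Measurable fun x : Fin m → ℝ =>
      ∏ j, unitPow (α (k.succAbove j)) (simplexPoint (m + 1) x (k.succAbove j)) := fun k =>
    Finset.measurable_prod _ fun j _ => (measurable_unitPow _).comp
      ((measurable_pi_apply (k.succAbove j)).comp (measurable_simplexPoint (m + 1)))
  have : ∫⁻ x : Fin m → ℝ, ∑ k, ENNReal.ofReal (max 1 ((((m : ℝ) + 1)⁻¹) ^ (α k - 1))) *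
        ∏ j, unitPow (α (k.succAbove j)) (simplexPoint (m + 1) x (k.succAbove j)) < ∞ := by
    rw [lintegral_finsetSum _ fun k _ => (hm' k).const_mul _]
    refine ENNReal.sum_lt_top.2 fun k _ => ?_
    rw [lintegral_const_mul _ (hm' k)]
    exact ENNReal.mul_lt_top ENNReal.ofReal_lt_top
      (lintegral_prod_unitPow_simplexPoint_lt_top hα k)
  exact this

theorem ae_one_sub_sum_ne_zero (m : ℕ) : ∀ᵐ x : Fin m → ℝ, 1 - ∑ i, x i ≠ 0 := by
  obtain _ | m := m
  · simp
  have h := lintegral_prod_mul_one_sub_sum (0 : Fin (m + 1)) (fun _ _ => 1)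
    (fun _ => measurable_const) (Set.indicator {0} fun _ => 1)
    (Measurable.indicator measurable_const (measurableSet_singleton 0))
  -- The hyperplane is null because `ψ`, the indicator of a point, has integral zero. The other
  -- factors may be infinite, but `∞ * 0 = 0`.
  have h0 : ∫⁻ t : ℝ, Set.indicator {0} (fun _ => (1 : ℝ≥0∞)) t = 0 := by
    rw [lintegral_indicator (measurableSet_singleton 0)]; simp
  rw [h0, mul_zero, lintegral_eq_zero_iff] at h
  · filter_upwards [h] with x hx h0
    simp [h0] at hx
  · exact Measurable.mul (by fun_prop) ((Measurable.indicator measurable_const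
      (measurableSet_singleton 0)).comp (by fun_prop))

theorem ae_simplexVolume_pos (m : ℕ) : ∀ᵐ x ∂simplexVolume (m + 1), ∀ ℓ, 0 < x ℓ := by
  have hR : MeasurableSet {x : Fin m → ℝ | (∀ j, 0 ≤ x j) ∧ ∑ j, x j ≤ 1} := by measurability
  rw [simplexVolume, ae_map_iff (measurable_simplexPoint _).aemeasurable (by measurability)]
  refine (ae_restrict_iff' hR).2 ?_
  have h2 : ∀ᵐ x : Fin m → ℝ, ∀ j, x j ≠ 0 := by
    rw [ae_all_iff]
    intro j
    exact Measure.ae_eval_ne (α := fun _ => ℝ) (fun _ => volume) j (0 : ℝ)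
  filter_upwards [ae_one_sub_sum_ne_zero m, h2] with x hx hx2 hxR ℓ
  induction ℓ using Fin.lastCases with
  | last => rw [simplexPoint_last]; exact lt_of_le_of_ne (by linarith [hxR.2]) hx.symm
  | cast j => rw [simplexPoint_castSucc]; exact lt_of_le_of_ne (hxR.1 j) (hx2 j).symm

theorem ae_simplexVolume_le_one (m : ℕ) : ∀ᵐ x ∂simplexVolume (m + 1), ∀ ℓ, x ℓ ≤ 1 :=
  ae_simplexVolume_of_forall (by measurability) fun _ h0 h1 ℓ =>
    h1 ▸ Finset.single_le_sum (fun i _ => h0 i) (Finset.mem_univ ℓ)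

theorem simplexVolume_ne_zero (m : ℕ) : simplexVolume (m + 1) ≠ 0 := by
  rw [simplexVolume, Ne, Measure.map_eq_zero_iff (measurable_simplexPoint _).aemeasurable,
    Measure.restrict_eq_zero]
  have hsub : (Set.univ.pi fun _ : Fin m => Set.Icc (0 : ℝ) ((m : ℝ) + 1)⁻¹) ⊆
      {x | (∀ j, 0 ≤ x j) ∧ ∑ j, x j ≤ 1} := by
    intro x hx
    refine ⟨fun j => (hx j trivial).1, ?_⟩
    calc ∑ j, x j ≤ ∑ _j : Fin m, ((m : ℝ) + 1)⁻¹ :=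
          Finset.sum_le_sum fun j _ => (hx j trivial).2
      _ = m / ((m : ℝ) + 1) := by simp [div_eq_mul_inv]
      _ ≤ 1 := by rw [div_le_one (by positivity)]; linarith
  intro h
  have h' := measure_mono_null hsub h
  rw [volume_pi, Measure.pi_pi] at h'
  simp only [Real.volume_Icc, sub_zero, Finset.prod_const, Finset.card_univ,
    Fintype.card_fin] at h'
  have h3 : ENNReal.ofReal (((m : ℝ) + 1)⁻¹) ≠ 0 := by
    rw [Ne, ENNReal.ofReal_eq_zero, not_le]; positivity
  exact pow_ne_zero _ h3 h'

instance isFiniteMeasure_simplexVolume (K : ℕ) : IsFiniteMeasure (simplexVolume K) := by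
  unfold simplexVolume
  have : IsFiniteMeasure ((volume : Measure (Fin (K - 1) → ℝ)).restrict
      {x | (∀ j, 0 ≤ x j) ∧ ∑ j, x j ≤ 1}) := by
    refine ⟨?_⟩
    rw [Measure.restrict_apply_univ]
    have hsub : {x : Fin (K - 1) → ℝ | (∀ j, 0 ≤ x j) ∧ ∑ j, x j ≤ 1} ⊆
        Set.univ.pi fun _ : Fin (K - 1) => Set.Icc (0 : ℝ) 1 := fun x hx j _ =>
      ⟨hx.1 j, (Finset.single_le_sum (fun i _ => hx.1 i) (Finset.mem_univ j)).trans hx.2⟩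
    refine (measure_mono hsub).trans_lt ?_
    rw [volume_pi, Measure.pi_pi]
    simp
  infer_instance

theorem pi_withDensity {m : ℕ} {E : Fin m → Type*} [∀ i, MeasurableSpace (E i)]
    (μ : ∀ i, Measure (E i)) [∀ i, SigmaFinite (μ i)] (f : ∀ i, E i → ℝ≥0∞)
    (hf : ∀ i, Measurable (f i)) [∀ i, SigmaFinite ((μ i).withDensity (f i))] :
    Measure.pi (fun i => (μ i).withDensity (f i))
      = (Measure.pi μ).withDensity fun x => ∏ i, f i (x i) := by
  refine Measure.pi_eq fun s hs => ?_
  rw [withDensity_apply _ (MeasurableSet.univ_pi hs), ← lintegral_indicator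
    (MeasurableSet.univ_pi hs)]
  have h : ∀ x, (Set.univ.pi s).indicator (fun x => ∏ i, f i (x i)) x
      = ∏ i, (s i).indicator (f i) (x i) := by
    intro x
    by_cases hx : x ∈ Set.univ.pi s
    · rw [Set.indicator_of_mem hx]
      exact Finset.prod_congr rfl fun i _ => (Set.indicator_of_mem (hx i trivial) _).symm
    · rw [Set.indicator_of_notMem hx]
      simp only [Set.mem_pi, Set.mem_univ, true_imp_iff, not_forall] at hx
      obtain ⟨i, hi⟩ := hx
      exact (Finset.prod_eq_zero (Finset.mem_univ i) (Set.indicator_of_notMem hi _)).symm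
  simp_rw [h]
  rw [lintegral_pi_prod _ _ fun i => (hf i).indicator (hs i)]
  exact Finset.prod_congr rfl fun i _ => by
    rw [lintegral_indicator (hs i), withDensity_apply _ (hs i)]

/-! ### The Dirichlet prior as a measure. -/

section TopicPrior

variable {K : ℕ} {α : Fin K → ℝ}

/-- The Dirichlet prior, as a measure on `ℝ^K`. -/
noncomputable def topicPrior (α : Fin K → ℝ) : Measure (Fin K → ℝ) :=
  (simplexVolume K).withDensity (dirichletPDF α)

theorem measurable_dirichletPDF (α : Fin K → ℝ) : Measurable (dirichletPDF α) := by
  unfold dirichletPDF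
  fun_prop

theorem dirichletConst_pos (hK : 0 < K) (hα : ∀ ℓ, 0 < α ℓ) :
    0 < Real.Gamma (∑ ℓ, α ℓ) / ∏ ℓ, Real.Gamma (α ℓ) := by
  have : Nonempty (Fin K) := ⟨⟨0, hK⟩⟩
  exact div_pos (Real.Gamma_pos_of_pos (Finset.sum_pos (fun ℓ _ => hα ℓ) Finset.univ_nonempty))
    (Finset.prod_pos fun ℓ _ => Real.Gamma_pos_of_pos (hα ℓ))

theorem dirichletPDF_eq (hK : 0 < K) (hα : ∀ ℓ, 0 < α ℓ) {x : Fin K → ℝ} (hx : ∀ ℓ, 0 < x ℓ) :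
    dirichletPDF α x = ENNReal.ofReal (Real.Gamma (∑ ℓ, α ℓ) / ∏ ℓ, Real.Gamma (α ℓ)) *
      ∏ ℓ, ENNReal.ofReal (x ℓ ^ (α ℓ - 1)) := by
  rw [dirichletPDF, ENNReal.ofReal_mul (dirichletConst_pos hK hα).le,
    ENNReal.ofReal_prod_of_nonneg fun ℓ _ => Real.rpow_nonneg (hx ℓ).le _]

theorem ae_pos_simplexVolume (hK : 0 < K) : ∀ᵐ x ∂simplexVolume K, ∀ ℓ, 0 < x ℓ := by
  obtain ⟨m, rfl⟩ := Nat.exists_eq_succ_of_ne_zero hK.ne'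
  exact ae_simplexVolume_pos m

theorem ae_dirichletPDF_ne_zero (hK : 0 < K) (hα : ∀ ℓ, 0 < α ℓ) :
    ∀ᵐ x ∂simplexVolume K, dirichletPDF α x ≠ 0 := by
  filter_upwards [ae_pos_simplexVolume hK] with x hx
  rw [dirichletPDF, Ne, ENNReal.ofReal_eq_zero, not_le]
  exact mul_pos (dirichletConst_pos hK hα)
    (Finset.prod_pos fun ℓ _ => Real.rpow_pos_of_pos (hx ℓ) _)

theorem topicPrior_absolutelyContinuous (α : Fin K → ℝ) : topicPrior α ≪ simplexVolume K :=
  withDensity_absolutelyContinuous _ _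

theorem ae_topicPrior (hK : 0 < K) : ∀ᵐ x ∂topicPrior α, ∀ ℓ, 0 < x ℓ ∧ x ℓ ≤ 1 := by
  refine (topicPrior_absolutelyContinuous α).ae_le ?_
  obtain ⟨m, rfl⟩ := Nat.exists_eq_succ_of_ne_zero hK.ne'
  filter_upwards [ae_simplexVolume_pos m, ae_simplexVolume_le_one m] with x h1 h2 ℓ
  exact ⟨h1 ℓ, h2 ℓ⟩

theorem lintegral_dirichletPDF_lt_top (hK : 0 < K) (hα : ∀ ℓ, 0 < α ℓ) :
    ∫⁻ x, dirichletPDF α x ∂simplexVolume K < ∞ := by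
  obtain ⟨m, rfl⟩ := Nat.exists_eq_succ_of_ne_zero hK.ne'
  have h : ∀ᵐ x ∂simplexVolume (m + 1), dirichletPDF α x =
      ENNReal.ofReal (Real.Gamma (∑ ℓ, α ℓ) / ∏ ℓ, Real.Gamma (α ℓ)) *
      ∏ ℓ, ENNReal.ofReal (x ℓ ^ (α ℓ - 1)) := by
    filter_upwards [ae_simplexVolume_pos m] with x hx using dirichletPDF_eq hK hα hx
  rw [lintegral_congr_ae h, lintegral_const_mul _ (by fun_prop)]
  exact ENNReal.mul_lt_top ENNReal.ofReal_lt_top (lintegral_prod_rpow_simplexVolume_lt_top hα)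

/-- Finiteness, together with nonvanishing below, is all that is used of the total mass: it cancels
between the evidence and `partition`, so the normalizing Gamma factor is never evaluated. -/
theorem isFiniteMeasure_topicPrior (hK : 0 < K) (hα : ∀ ℓ, 0 < α ℓ) :
    IsFiniteMeasure (topicPrior α) :=
  isFiniteMeasure_withDensity (lintegral_dirichletPDF_lt_top hK hα).ne

theorem simplexVolume_absolutelyContinuous_topicPrior (hK : 0 < K) (hα : ∀ ℓ, 0 < α ℓ) :
    simplexVolume K ≪ topicPrior α :=
  withDensity_absolutelyContinuous' (measurable_dirichletPDF α).aemeasurable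
    (ae_dirichletPDF_ne_zero hK hα)

theorem topicPrior_ne_zero (hK : 0 < K) (hα : ∀ ℓ, 0 < α ℓ) : topicPrior α ≠ 0 := by
  intro h
  have h' := simplexVolume_absolutelyContinuous_topicPrior hK hα
  rw [h, Measure.absolutelyContinuous_zero_iff] at h'
  obtain ⟨m, rfl⟩ := Nat.exists_eq_succ_of_ne_zero hK.ne'
  exact simplexVolume_ne_zero m h'

/-- Since `|log t| * t ^ (a / 2)` is bounded on `(0, 1]`, the logarithm costs only half of the
exponent `α ℓ`. The integrand is therefore dominated by a Dirichlet weight with `α ℓ` halved. -/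
theorem integrable_log_topicPrior (hK : 0 < K) (hα : ∀ ℓ, 0 < α ℓ) (ℓ : Fin K) :
    Integrable (fun x => Real.log (x ℓ)) (topicPrior α) := by
  refine ⟨(Real.measurable_log.comp (measurable_pi_apply ℓ)).aestronglyMeasurable, ?_⟩
  set c := Real.Gamma (∑ ℓ, α ℓ) / ∏ ℓ, Real.Gamma (α ℓ)
  set β : Fin K → ℝ := Function.update α ℓ (α ℓ / 2) with hβ
  have hβpos : ∀ k, 0 < β k := by
    intro k
    rcases eq_or_ne k ℓ with rfl | hk
    · simpa [hβ] using half_pos (hα k)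
    · simpa [hβ, hk] using hα k
  rw [HasFiniteIntegral, topicPrior,
    lintegral_withDensity_eq_lintegral_mul _ (measurable_dirichletPDF α) (by fun_prop)]
  have hle : ∀ᵐ x ∂simplexVolume K,
      (dirichletPDF α * fun x : Fin K → ℝ => ‖Real.log (x ℓ)‖ₑ) x ≤
      ENNReal.ofReal c * ENNReal.ofReal (1 / (α ℓ / 2)) *
        ∏ k, ENNReal.ofReal (x k ^ (β k - 1)) := by
    have hle1 : ∀ᵐ x : Fin K → ℝ ∂simplexVolume K, ∀ ℓ, x ℓ ≤ 1 := by
      obtain ⟨m, rfl⟩ := Nat.exists_eq_succ_of_ne_zero hK.ne'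
      exact ae_simplexVolume_le_one m
    filter_upwards [ae_pos_simplexVolume hK, hle1] with x hx hx1
    rw [Pi.mul_apply, dirichletPDF_eq hK hα hx, mul_assoc, mul_assoc]
    refine mul_le_mul' le_rfl ?_
    rw [← Finset.mul_prod_erase _ _ (Finset.mem_univ ℓ), ← Finset.mul_prod_erase
      (a := ℓ) _ (fun k => ENNReal.ofReal (x k ^ (β k - 1))) (Finset.mem_univ ℓ)]
    have herase : ∏ k ∈ Finset.univ.erase ℓ, ENNReal.ofReal (x k ^ (β k - 1))
        = ∏ k ∈ Finset.univ.erase ℓ, ENNReal.ofReal (x k ^ (α k - 1)) :=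
      Finset.prod_congr rfl fun k hk => by simp [hβ, Finset.ne_of_mem_erase hk]
    rw [herase, mul_right_comm, ← mul_assoc]
    refine mul_le_mul' ?_ le_rfl
    rw [Real.enorm_eq_ofReal_abs, ← ENNReal.ofReal_mul (Real.rpow_nonneg (hx ℓ).le _),
      ← ENNReal.ofReal_mul (by have := hα ℓ; positivity)]
    refine ENNReal.ofReal_le_ofReal ?_
    have h1 := (Real.abs_log_mul_self_rpow_lt (x ℓ) (α ℓ / 2) (hx ℓ) (hx1 ℓ)
      (half_pos (hα ℓ))).le
    rw [abs_mul, abs_of_pos (Real.rpow_pos_of_pos (hx ℓ) _)] at h1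
    have h2 : x ℓ ^ (α ℓ - 1) = x ℓ ^ (α ℓ / 2) * x ℓ ^ (β ℓ - 1) := by
      rw [← Real.rpow_add (hx ℓ)]
      congr 1
      simp only [hβ, Function.update_self]
      ring
    rw [h2]
    calc x ℓ ^ (α ℓ / 2) * x ℓ ^ (β ℓ - 1) * |Real.log (x ℓ)|
        = (|Real.log (x ℓ)| * x ℓ ^ (α ℓ / 2)) * x ℓ ^ (β ℓ - 1) := by ring
      _ ≤ _ := mul_le_mul_of_nonneg_right h1 (Real.rpow_nonneg (hx ℓ).le _)
  refine (lintegral_mono_ae hle).trans_lt ?_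
  rw [lintegral_const_mul _ (by fun_prop)]
  refine ENNReal.mul_lt_top (ENNReal.mul_lt_top ENNReal.ofReal_lt_top ENNReal.ofReal_lt_top) ?_
  obtain ⟨m, rfl⟩ := Nat.exists_eq_succ_of_ne_zero hK.ne'
  exact lintegral_prod_rpow_simplexVolume_lt_top hβpos

end TopicPrior

/-! ### Likelihood ratios of densities, and Gibbs' inequality. -/

section Llr

variable {Ω : Type*} [MeasurableSpace Ω] {B : Measure Ω} {p m : Ω → ℝ≥0∞}

theorem withDensity_absolutelyContinuous_withDensity (hm : Measurable m)
    (h : ∀ᵐ x ∂B, m x = 0 → p x = 0) : B.withDensity p ≪ B.withDensity m := by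
  refine Measure.AbsolutelyContinuous.mk fun s hs h0 => ?_
  rw [withDensity_apply _ hs] at h0 ⊢
  rw [lintegral_eq_zero_iff hm] at h0
  refine lintegral_eq_zero_of_ae_eq_zero ?_
  filter_upwards [h0, ae_restrict_of_ae h] with x h1 h2 using h2 h1

/-- The positivity conclusions allow the logarithm of a product density to be split into a sum. -/
theorem llr_withDensity_withDensity [SigmaFinite B] (hp : Measurable p) (hm : Measurable m)
    [IsFiniteMeasure (B.withDensity p)] [IsFiniteMeasure (B.withDensity m)]
    (h : B.withDensity p ≪ B.withDensity m) :
    ∀ᵐ x ∂B.withDensity p, 0 < (p x).toReal ∧ 0 < (m x).toReal ∧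
      llr (B.withDensity p) (B.withDensity m) x
        = Real.log (p x).toReal - Real.log (m x).toReal := by
  have hpB := withDensity_absolutelyContinuous B p
  have hptop : ∀ᵐ x ∂B, p x < ∞ := ae_lt_top hp (by
    have := measure_ne_top (B.withDensity p) Set.univ
    rwa [withDensity_apply _ MeasurableSet.univ, setLIntegral_univ] at this)
  have hmtop : ∀ᵐ x ∂B, m x < ∞ := ae_lt_top hm (by
    have := measure_ne_top (B.withDensity m) Set.univ
    rwa [withDensity_apply _ MeasurableSet.univ, setLIntegral_univ] at this)
  have hp0 : ∀ᵐ x ∂B.withDensity p, p x ≠ 0 :=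
    (ae_withDensity_iff hp).2 (ae_of_all _ fun _ h => h)
  have hm0 : ∀ᵐ x ∂B.withDensity m, m x ≠ 0 :=
    (ae_withDensity_iff hm).2 (ae_of_all _ fun _ h => h)
  filter_upwards [hpB.ae_le hptop, hpB.ae_le hmtop, hp0, h.ae_le hm0,
    hpB.ae_le (Measure.rnDeriv_withDensity B hp), hpB.ae_le (Measure.rnDeriv_withDensity B hm),
    h.ae_le (Measure.rnDeriv_eq_div hpB (withDensity_absolutelyContinuous B m))]
    with x h1 h2 h3 h4 h5 h6 h7
  have hP := ENNReal.toReal_pos h3 h1.ne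
  have hM := ENNReal.toReal_pos h4 h2.ne
  refine ⟨hP, hM, ?_⟩
  rw [llr, h7, h5, h6, ENNReal.toReal_div, Real.log_div hP.ne' hM.ne']

end Llr

/-- **Gibbs' inequality** for finite sums. -/
theorem sum_mul_log_le_sum_mul_log {ι : Type*} [Fintype ι] {ρ q : ι → ℝ} (hρ : ∀ z, 0 ≤ ρ z)
    (hρ1 : ∑ z, ρ z = 1) (hq : ∀ z, 0 ≤ q z) (hq1 : ∑ z, q z ≤ 1)
    (hsupp : ∀ z, ρ z ≠ 0 → q z ≠ 0) :
    ∑ z, ρ z * Real.log (q z) ≤ ∑ z, ρ z * Real.log (ρ z) := by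
  -- This is `log t ≤ t - 1` at `t = q / ρ`, multiplied by `ρ`; the linear terms have nonpositive
  -- sum.
  have h : ∀ z, ρ z * Real.log (q z) ≤ ρ z * Real.log (ρ z) + (q z - ρ z) := by
    intro z
    rcases eq_or_ne (ρ z) 0 with h0 | h0
    · simp [h0, hq z]
    have hρz : 0 < ρ z := lt_of_le_of_ne (hρ z) h0.symm
    have hqz : 0 < q z := lt_of_le_of_ne (hq z) (hsupp z h0).symm
    have h1 := Real.log_le_sub_one_of_pos (div_pos hqz hρz)
    rw [Real.log_div hqz.ne' h0] at h1
    have h2 := mul_le_mul_of_nonneg_left h1 hρz.le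
    have h3 : ρ z * (q z / ρ z - 1) = q z - ρ z := by field_simp
    linarith
  have := Finset.sum_le_sum fun z (_ : z ∈ Finset.univ) => h z
  rw [Finset.sum_add_distrib, Finset.sum_sub_distrib, hρ1] at this
  linarith

/-! ### Product weights, counts and the feasible set. -/

namespace LDAModel

variable (M : LDAModel)

/-- Families of real weights, one for each word and topic. -/
abbrev Weights : Type := (d : Fin M.D) → Fin (M.len d) → Fin M.K → ℝ

variable {M}

/-- The product of the weights of the topics `z`. -/
def prodWeight (ζ : M.Weights) (z : M.Topics) : ℝ := ∏ d, ∏ i, ζ d i (z d i)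

/-- The numbers of words of each document that are assigned to each topic. -/
def count (z : M.Topics) (d : Fin M.D) (ℓ : Fin M.K) : ℕ :=
  (Finset.univ.filter fun i => z d i = ℓ).card

/-- The expected numbers of words of each document that are assigned to each topic. -/
def expCount (ζ : M.Weights) (d : Fin M.D) (ℓ : Fin M.K) : ℝ := ∑ i, ζ d i ℓ

/-- The likelihoods of the topics of each word. -/
def wordLik (M : LDAModel) (X : M.Data) : M.Weights := fun d i ℓ => M.η ℓ (X d i)

/-- The mean-field parameters that are compatible with the data. -/
def feasible (M : LDAModel) (X : M.Data) : Set M.Weights :=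
  {ζ | (∀ d i ℓ, 0 ≤ ζ d i ℓ) ∧ (∀ d i, ∑ ℓ, ζ d i ℓ = 1) ∧
    ∀ d i ℓ, M.wordLik X d i ℓ = 0 → ζ d i ℓ = 0}

/-- The contribution of the topics to the variational objective. -/
noncomputable def topicEnergy (M : LDAModel) (X : M.Data) (ζ : M.Weights) : ℝ :=
  ∑ d, ∑ i, ∑ ℓ, ζ d i ℓ * (Real.log (ζ d i ℓ) - Real.log (M.wordLik X d i ℓ))

theorem wordLik_nonneg (X : M.Data) (d : Fin M.D) (i : Fin (M.len d)) (ℓ : Fin M.K) :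
    0 ≤ M.wordLik X d i ℓ := M.η_nonneg _ _

theorem sum_prod_prod {R : Type*} [CommSemiring R]
    (g : (d : Fin M.D) → Fin (M.len d) → Fin M.K → R) :
    ∑ z : M.Topics, ∏ d, ∏ i, g d i (z d i) = ∏ d, ∏ i, ∑ ℓ, g d i ℓ := by
  simp_rw [Fintype.prod_sum]

theorem prodWeight_nonneg {ζ : M.Weights} (h : ∀ d i ℓ, 0 ≤ ζ d i ℓ) (z : M.Topics) :
    0 ≤ prodWeight ζ z :=
  Finset.prod_nonneg fun d _ => Finset.prod_nonneg fun i _ => h d i _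

theorem prodWeight_ne_zero {ζ : M.Weights} {z : M.Topics} :
    prodWeight ζ z ≠ 0 ↔ ∀ d i, ζ d i (z d i) ≠ 0 := by
  simp [prodWeight, Finset.prod_ne_zero_iff]

theorem log_prodWeight {ζ : M.Weights} {z : M.Topics} (h : prodWeight ζ z ≠ 0) :
    Real.log (prodWeight ζ z) = ∑ d, ∑ i, Real.log (ζ d i (z d i)) := by
  rw [prodWeight_ne_zero] at h
  rw [prodWeight, Real.log_prod fun d _ => Finset.prod_ne_zero_iff.2 fun i _ => h d i]
  exact Finset.sum_congr rfl fun d _ => Real.log_prod fun i _ => h d i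

theorem sum_prodWeight {ζ : M.Weights} (h : ∀ d i, ∑ ℓ, ζ d i ℓ = 1) :
    ∑ z, prodWeight ζ z = 1 := by
  simp [prodWeight, sum_prod_prod, h]

theorem sum_prodWeight_mul {ζ : M.Weights} (h : ∀ d i, ∑ ℓ, ζ d i ℓ = 1) (d : Fin M.D)
    (i : Fin (M.len d)) (f : Fin M.K → ℝ) :
    ∑ z, prodWeight ζ z * f (z d i) = ∑ ℓ, ζ d i ℓ * f ℓ := by
  -- Tilt the weight of the one word `(d, i)` by `f`; all other factors still sum to one. Words are
  -- compared in the sigma type because the type of `i'` depends on `d'`.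
  set g : M.Weights := fun d' i' ℓ =>
    ζ d' i' ℓ * if (⟨d', i'⟩ : Σ d, Fin (M.len d)) = ⟨d, i⟩ then f ℓ else 1 with hg
  have h1 : ∀ z, prodWeight ζ z * f (z d i) = ∏ d', ∏ i', g d' i' (z d' i') := by
    intro z
    simp only [hg, Finset.prod_mul_distrib]
    rw [prodWeight]
    congr 1
    rw [Finset.prod_eq_single d, Finset.prod_eq_single i]
    · simp
    · intro i' _ hi'
      simp [hi']
    · simp
    · intro d' _ hd'
      refine Finset.prod_eq_one fun i' _ => ?_
      simp [hd']
    · simp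
  simp_rw [h1]
  rw [sum_prod_prod, Finset.prod_eq_single d, Finset.prod_eq_single i]
  · simp [hg]
  · intro i' _ hi'
    simp [hg, hi', h]
  · simp
  · intro d' _ hd'
    refine Finset.prod_eq_one fun i' _ => ?_
    simp [hg, hd', h]
  · simp

theorem sum_prodWeight_mul_sum {ζ : M.Weights} (h : ∀ d i, ∑ ℓ, ζ d i ℓ = 1) (f : M.Weights) :
    ∑ z, prodWeight ζ z * ∑ d, ∑ i, f d i (z d i) = ∑ d, ∑ i, ∑ ℓ, ζ d i ℓ * f d i ℓ := by
  simp_rw [Finset.mul_sum]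
  rw [Finset.sum_comm]
  refine Finset.sum_congr rfl fun d _ => ?_
  rw [Finset.sum_comm]
  exact Finset.sum_congr rfl fun i _ => sum_prodWeight_mul h d i _

/-- Grouping words by topic is what makes the proportions see `z` only through its counts. -/
theorem sum_comp_topics (z : M.Topics) (d : Fin M.D) (g : Fin M.K → ℝ) :
    ∑ i, g (z d i) = ∑ ℓ, (count z d ℓ : ℝ) * g ℓ := by
  rw [← Finset.sum_fiberwise (s := Finset.univ) (g := fun i => z d i)]
  refine Finset.sum_congr rfl fun ℓ _ => ?_
  rw [Finset.sum_congr rfl (g := fun _ => g ℓ) fun i hi => by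
    rw [(Finset.mem_filter.1 hi).2], Finset.sum_const, nsmul_eq_mul, count]

theorem sum_count (z : M.Topics) (d : Fin M.D) : ∑ ℓ, count z d ℓ = M.len d := by
  have := sum_comp_topics z d fun _ => 1
  simp at this
  exact_mod_cast this.symm

theorem prodWeight_wordLik_ne_zero {X : M.Data} {ζ : M.Weights} (hζ : ζ ∈ M.feasible X)
    {z : M.Topics} (h : prodWeight ζ z ≠ 0) : prodWeight (M.wordLik X) z ≠ 0 := by
  rw [prodWeight_ne_zero] at h ⊢
  exact fun d i h0 => h d i (hζ.2.2 d i _ h0)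

theorem isCompact_feasible (X : M.Data) : IsCompact (M.feasible X) := by
  have hsub : M.feasible X ⊆ Set.Icc 0 1 := fun ζ hζ =>
    ⟨fun d i ℓ => hζ.1 d i ℓ, fun d i ℓ =>
      (Finset.single_le_sum (fun k _ => hζ.1 d i k) (Finset.mem_univ ℓ)).trans_eq (hζ.2.1 d i)⟩
  refine IsCompact.of_isClosed_subset isCompact_Icc ?_ hsub
  simp only [feasible, Set.ofPred_and, Set.ofPred_forall]
  refine IsClosed.inter ?_ (IsClosed.inter ?_ ?_)
  · exact isClosed_iInter fun d => isClosed_iInter fun i => isClosed_iInter fun ℓ =>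
      isClosed_le (by fun_prop) (by fun_prop)
  · exact isClosed_iInter fun d => isClosed_iInter fun i =>
      isClosed_eq (by fun_prop) (by fun_prop)
  · exact isClosed_iInter fun d => isClosed_iInter fun i => isClosed_iInter fun ℓ =>
      isClosed_iInter fun _ => isClosed_eq (by fun_prop) (by fun_prop)

/-- `t log t` extends continuously to zero, and the log-likelihoods are constants in `ζ`. A zero
likelihood contributes `log 0 = 0`; it is `feasible` that rules out the infinite energy it stands
for. -/
theorem continuous_topicEnergy (X : M.Data) : Continuous (M.topicEnergy X) := by
  unfold topicEnergy
  simp_rw [mul_sub]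
  refine continuous_finsetSum _ fun d _ => continuous_finsetSum _ fun i _ =>
    continuous_finsetSum _ fun ℓ _ => Continuous.sub ?_ (by fun_prop)
  exact Real.continuous_mul_log.comp (f := fun ζ : M.Weights => ζ d i ℓ) (by fun_prop)

/-! ### From a fibre of the counts to a product law. -/

/-- Given counts `c` that are possible for the data, there are compatible mean-field parameters
with expected counts `c`, and whose energy is bounded by subadditivity of the entropy. -/
theorem exists_feasible_of_count (X : M.Data) (c : Fin M.D → Fin M.K → ℕ)
    (hc : 0 < ∑ z with count z = c, prodWeight (M.wordLik X) z) :
    ∃ ζ ∈ M.feasible X, (∀ d ℓ, expCount ζ d ℓ = c d ℓ) ∧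
      M.topicEnergy X ζ ≤ -Real.log (∑ z with count z = c, prodWeight (M.wordLik X) z) := by
  classical
  set h := prodWeight (M.wordLik X) with hh
  set S := ∑ z with count z = c, h z with hS
  have hh0 : ∀ z, 0 ≤ h z := prodWeight_nonneg (wordLik_nonneg X)
  -- The law proportional to the likelihood on the fibre of `c`; `ζ` below consists of its one-word
  -- marginals.
  set ρ : M.Topics → ℝ := fun z => if count z = c then h z / S else 0 with hρ
  have hρ0 : ∀ z, 0 ≤ ρ z := fun z => by
    simp only [hρ]; split_ifs
    · exact div_nonneg (hh0 z) hc.le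
    · exact le_rfl
  have hρ1 : ∑ z, ρ z = 1 := by
    simp only [hρ, ← Finset.sum_filter, ← Finset.sum_div]
    exact div_self hc.ne'
  have hρne : ∀ z, ρ z ≠ 0 → count z = c ∧ h z ≠ 0 ∧ ρ z = h z / S := by
    intro z hz
    simp only [hρ] at hz ⊢
    split_ifs at hz with h1
    · refine ⟨h1, fun h0 => hz (by simp [h0]), by simp [h1]⟩
    · exact absurd rfl hz
  set ζ : M.Weights := fun d i ℓ => ∑ z, if z d i = ℓ then ρ z else 0 with hζ
  have hmarg : ∀ d i (f : Fin M.K → ℝ), ∑ ℓ, ζ d i ℓ * f ℓ = ∑ z, ρ z * f (z d i) := by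
    intro d i f
    simp only [hζ, Finset.sum_mul]
    rw [Finset.sum_comm]
    refine Finset.sum_congr rfl fun z _ => ?_
    simp [ite_mul]
  have hζ0 : ∀ d i ℓ, 0 ≤ ζ d i ℓ := fun d i ℓ => Finset.sum_nonneg fun z _ => by
    split_ifs
    · exact hρ0 z
    · exact le_rfl
  have hζ1 : ∀ d i, ∑ ℓ, ζ d i ℓ = 1 := fun d i => by
    simpa [hρ1] using hmarg d i fun _ => 1
  -- A joint law is supported where the product of its marginals is, the support condition of Gibbs'
  -- inequality.
  have hζpos : ∀ z, ρ z ≠ 0 → prodWeight ζ z ≠ 0 := by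
    intro z hz
    rw [prodWeight_ne_zero]
    intro d i
    have : ρ z ≤ ζ d i (z d i) := by
      have := Finset.single_le_sum (f := fun z' => if z' d i = z d i then ρ z' else 0)
        (fun z' _ => by
          split_ifs
          · exact hρ0 z'
          · exact le_rfl) (Finset.mem_univ z)
      simpa using this
    exact ((lt_of_le_of_ne (hρ0 z) hz.symm).trans_le this).ne'
  have hfeas : ζ ∈ M.feasible X := by
    refine ⟨hζ0, hζ1, fun d i ℓ h0 => Finset.sum_eq_zero fun z _ => ?_⟩
    split_ifs with hz
    · by_contra hne
      have := (hρne z hne).2.1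
      rw [hh, prodWeight_ne_zero] at this
      exact this d i (hz ▸ h0)
    · rfl
  refine ⟨ζ, hfeas, fun d ℓ => ?_, ?_⟩
  · have h1 : ∀ i, ζ d i ℓ = ∑ z, ρ z * if z d i = ℓ then 1 else 0 := fun i => by
      simp [hζ]
    simp only [expCount, h1]
    rw [Finset.sum_comm]
    simp_rw [← Finset.mul_sum]
    -- The count is constantly `c` on the support of `ρ`, and expected counts depend on marginals
    -- only.
    have h2 : ∀ z, ρ z * ∑ i, (if z d i = ℓ then (1 : ℝ) else 0) = ρ z * c d ℓ := by
      intro z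
      rcases eq_or_ne (ρ z) 0 with h0 | h0
      · simp [h0]
      · rw [← (hρne z h0).1]
        simp [count]
    simp_rw [h2, ← Finset.sum_mul, hρ1, one_mul]
  -- The energy is a sum over words, so it may be averaged under `ρ` instead of the product of its
  -- marginals.
  · have h1 : M.topicEnergy X ζ = ∑ z, ρ z * (Real.log (prodWeight ζ z) - Real.log (h z)) := by
      have h2 : ∀ z, ρ z * (Real.log (prodWeight ζ z) - Real.log (h z)) =
          ∑ d, ∑ i, ρ z * (Real.log (ζ d i (z d i)) - Real.log (M.wordLik X d i (z d i))) := by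
        intro z
        rcases eq_or_ne (ρ z) 0 with h0 | h0
        · simp [h0]
        · rw [log_prodWeight (hζpos z h0), hh, log_prodWeight (hρne z h0).2.1]
          simp_rw [← Finset.mul_sum, ← Finset.sum_sub_distrib]
      simp_rw [h2]
      rw [Finset.sum_comm]
      refine Finset.sum_congr rfl fun d _ => ?_
      rw [Finset.sum_comm (s := (Finset.univ : Finset M.Topics))]
      exact Finset.sum_congr rfl fun i _ =>
        hmarg d i fun ℓ => Real.log (ζ d i ℓ) - Real.log (M.wordLik X d i ℓ)
    -- Subadditivity of entropy: Gibbs' inequality for `ρ` against the product of its marginals.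
    have h3 := sum_mul_log_le_sum_mul_log hρ0 hρ1 (prodWeight_nonneg hζ0) (sum_prodWeight hζ1).le
      hζpos
    have h4 : ∑ z, ρ z * Real.log (ρ z) = ∑ z, ρ z * Real.log (h z) - Real.log S := by
      have : ∀ z, ρ z * Real.log (ρ z) = ρ z * Real.log (h z) - ρ z * Real.log S := by
        intro z
        rcases eq_or_ne (ρ z) 0 with h0 | h0
        · simp [h0]
        · obtain ⟨-, h5, h6⟩ := hρne z h0
          have h7 : Real.log (ρ z) = Real.log (h z) - Real.log S := by
            rw [h6, Real.log_div h5 hc.ne']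
          rw [h7, mul_sub]
      simp_rw [this, Finset.sum_sub_distrib, ← Finset.sum_mul, hρ1, one_mul]
    rw [h1]
    simp_rw [mul_sub, Finset.sum_sub_distrib]
    linarith

/-! ### The number of count tables. -/

/-- The counts that occur. -/
noncomputable def countSet (M : LDAModel) : Finset (Fin M.D → Fin M.K → ℕ) := by
  classical exact Finset.univ.image (count (M := M))

theorem count_mem_countSet (z : M.Topics) : count z ∈ M.countSet := by
  classical
  simp [countSet]

theorem sum_len_eq : ∑ d, M.len d = M.n := rfl

/-- Take independent geometric variables of ratio `x`, one per document and topic. Every table that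
occurs has total `n`, hence the same probability `(1 - x) ^ (D K) * x ^ n`, and these probabilities
add up to at most one. -/
theorem card_countSet_mul_le {x : ℝ} (h0 : 0 ≤ x) (h1 : x < 1) :
    (M.countSet.card : ℝ) * ((1 - x) ^ (M.D * M.K) * x ^ M.n) ≤ 1 := by
  classical
  set T : Finset (Fin M.D → Fin M.K → ℕ) :=
    Fintype.piFinset fun _ => Fintype.piFinset fun _ => Finset.range (M.n + 1)
  have hsub : M.countSet ⊆ T := by
    intro c hc
    obtain ⟨z, -, rfl⟩ := Finset.mem_image.1 (show c ∈ Finset.univ.image count by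
      simpa [countSet] using hc)
    simp only [T, Fintype.mem_piFinset, Finset.mem_range, Nat.lt_succ_iff]
    intro d ℓ
    calc count z d ℓ ≤ ∑ ℓ, count z d ℓ :=
          Finset.single_le_sum (fun _ _ => Nat.zero_le _) (Finset.mem_univ ℓ)
      _ = M.len d := sum_count z d
      _ ≤ M.n := Finset.single_le_sum (f := M.len) (fun _ _ => Nat.zero_le _) (Finset.mem_univ d)
  have hval : ∀ c ∈ M.countSet,
      ∏ d, ∏ ℓ, ((1 - x) * x ^ c d ℓ) = (1 - x) ^ (M.D * M.K) * x ^ M.n := by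
    intro c hc
    obtain ⟨z, -, rfl⟩ := Finset.mem_image.1 (show c ∈ Finset.univ.image count by
      simpa [countSet] using hc)
    simp only [Finset.prod_mul_distrib, Finset.prod_const, Finset.card_univ, Fintype.card_fin,
      Finset.prod_pow_eq_pow_sum, sum_count, sum_len_eq]
    rw [← pow_mul, mul_comm M.K]
  have hgeom : ∑ j ∈ Finset.range (M.n + 1), (1 - x) * x ^ j ≤ 1 := by
    rw [← Finset.mul_sum, mul_comm, geom_sum_mul_neg]
    linarith [pow_nonneg h0 (M.n + 1)]
  have hgeom0 : 0 ≤ ∑ j ∈ Finset.range (M.n + 1), (1 - x) * x ^ j :=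
    Finset.sum_nonneg fun j _ => mul_nonneg (by linarith) (pow_nonneg h0 j)
  calc (M.countSet.card : ℝ) * ((1 - x) ^ (M.D * M.K) * x ^ M.n)
      = ∑ c ∈ M.countSet, ∏ d, ∏ ℓ, ((1 - x) * x ^ c d ℓ) := by
        rw [Finset.sum_congr rfl hval, Finset.sum_const, nsmul_eq_mul]
    _ ≤ ∑ c ∈ T, ∏ d, ∏ ℓ, ((1 - x) * x ^ c d ℓ) :=
        Finset.sum_le_sum_of_subset_of_nonneg hsub fun c _ _ => Finset.prod_nonneg fun d _ =>
          Finset.prod_nonneg fun ℓ _ => mul_nonneg (by linarith) (pow_nonneg h0 _)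
    _ = ∏ _d : Fin M.D, ∏ _ℓ : Fin M.K, ∑ j ∈ Finset.range (M.n + 1), (1 - x) * x ^ j := by
        simp only [T]
        rw [← Finset.prod_univ_sum (fun _ : Fin M.D => Fintype.piFinset
          fun _ : Fin M.K => Finset.range (M.n + 1)) fun _ c => ∏ ℓ, ((1 - x) * x ^ c ℓ)]
        refine Finset.prod_congr rfl fun d _ => ?_
        rw [Finset.prod_univ_sum]
    _ ≤ 1 := Finset.prod_le_one (fun _ _ => Finset.prod_nonneg fun _ _ => hgeom0) fun _ _ =>
        Finset.prod_le_one (fun _ _ => hgeom0) fun _ _ => hgeom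

theorem n_pos (M : LDAModel) : 0 < M.n :=
  (M.len_pos ⟨0, M.D_pos⟩).trans_le
    (Finset.single_le_sum (f := M.len) (fun _ _ => Nat.zero_le _) (Finset.mem_univ _))

theorem DK_pos (M : LDAModel) : 0 < M.D * M.K := Nat.mul_pos M.D_pos M.K_pos

theorem one_le_card_countSet : 1 ≤ M.countSet.card :=
  Finset.card_pos.2 ⟨_, count_mem_countSet fun _ _ => ⟨0, M.K_pos⟩⟩

theorem log_card_countSet_le : Real.log M.countSet.card ≤ M.n * (3 * M.rate) := by
  have hn : (0 : ℝ) < M.n := by exact_mod_cast M.n_pos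
  have hk : (0 : ℝ) < (M.D * M.K : ℕ) := by exact_mod_cast M.DK_pos
  set n : ℝ := Nat.cast M.n with hndef
  set k : ℝ := Nat.cast (M.D * M.K) with hkdef
  have hcard : (0 : ℝ) < M.countSet.card := by exact_mod_cast one_le_card_countSet
  -- The choice `x = n / (n + k)` maximizes `(1 - x) ^ k * x ^ n`.
  have hx : 1 - n / (n + k) = k / (n + k) := by field_simp; ring
  have h := card_countSet_mul_le (M := M) (x := n / (n + k)) (by positivity)
    (by rw [div_lt_one (by positivity)]; linarith)
  rw [hx] at h
  have hlog := Real.log_le_log (by positivity) h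
  rw [Real.log_one, Real.log_mul (by positivity) (by positivity),
    Real.log_mul (by positivity) (by positivity), Real.log_pow, Real.log_pow] at hlog
  change Real.log M.countSet.card + (k * Real.log (k / (n + k)) + n * Real.log (n / (n + k))) ≤ 0
    at hlog
  have h1 : n * Real.log ((n + k) / n) ≤ k := by
    have := Real.log_le_sub_one_of_pos (show 0 < (n + k) / n by positivity)
    calc n * Real.log ((n + k) / n) ≤ n * ((n + k) / n - 1) :=
          mul_le_mul_of_nonneg_left this hn.le
      _ = k := by field_simp; ring
  have h2 : Real.log (n / (n + k)) = -Real.log ((n + k) / n) := by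
    rw [← Real.log_inv, inv_div]
  have h3 : Real.log (k / (n + k)) = -Real.log ((n + k) / k) := by
    rw [← Real.log_inv, inv_div]
  have h4 : Real.log ((n + k) / k) ≤ Real.log (n / k + 2) := by
    refine Real.log_le_log (by positivity) ?_
    rw [add_div, div_self hk.ne']
    linarith
  -- Since `log 2 > 1 / 2`, the leftover `k` is absorbed as `2 k log (n / k + 2)`; with the main
  -- term this makes the constant 3.
  have h5 : 1 ≤ 2 * Real.log (n / k + 2) := by
    have := Real.log_le_log two_pos (show 2 ≤ n / k + 2 by linarith [div_pos hn hk])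
    linarith [Real.log_two_gt_d9]
  have h6 : n * (3 * M.rate) = 3 * (k * Real.log (n / k + 2)) := by
    have : M.rate = k / n * Real.log (n / k + 2) := by simp [rate, hkdef, hndef]
    rw [this]
    field_simp
  rw [h6]
  rw [h2, h3] at hlog
  have h7 := mul_le_mul_of_nonneg_left h4 hk.le
  have h8 := mul_le_mul_of_nonneg_left h5 hk.le
  linarith


/-! ### Dirichlet moments and the posterior in closed form. -/

instance isFiniteMeasure_topicPrior_alpha (M : LDAModel) : IsFiniteMeasure (topicPrior M.α) :=
  isFiniteMeasure_topicPrior M.K_pos M.α_pos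

instance neZero_topicPrior_alpha (M : LDAModel) : NeZero (topicPrior M.α) :=
  ⟨topicPrior_ne_zero M.K_pos M.α_pos⟩

/-- The prior distribution of the topic proportions. -/
noncomputable def proportionsPrior (M : LDAModel) : Measure M.Proportions :=
  Measure.pi fun _ => topicPrior M.α

instance (M : LDAModel) : IsFiniteMeasure M.proportionsPrior := by
  unfold proportionsPrior; infer_instance

instance (M : LDAModel) : NeZero M.proportionsPrior := by
  refine ⟨fun h => ?_⟩
  have h' : M.proportionsPrior Set.univ = 0 := by rw [h]; rfl
  rw [proportionsPrior, Measure.pi_univ, Finset.prod_eq_zero_iff] at h'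
  obtain ⟨d, -, hd⟩ := h'
  exact NeZero.ne (topicPrior M.α) (Measure.measure_univ_eq_zero.1 hd)

/-- The linear form `N` of the logarithms of the topic proportions. -/
noncomputable def logForm (N : Fin M.D → Fin M.K → ℝ) (π : M.Proportions) : ℝ :=
  ∑ d, ∑ ℓ, N d ℓ * Real.log (π d ℓ)

@[fun_prop]
theorem measurable_logForm (N : Fin M.D → Fin M.K → ℝ) : Measurable (logForm N) := by
  unfold logForm
  refine Finset.measurable_sum _ fun d _ => Finset.measurable_sum _ fun ℓ _ =>
    Measurable.const_mul ?_ _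
  exact Real.measurable_log.comp ((measurable_pi_apply ℓ).comp (measurable_pi_apply d))

/-- The prior expectation of `∏ π_{dℓ} ^ N_{dℓ}`. -/
noncomputable def partition (N : Fin M.D → Fin M.K → ℝ) : ℝ :=
  ∫ π, Real.exp (logForm N π) ∂M.proportionsPrior

theorem ae_proportionsPrior (M : LDAModel) :
    ∀ᵐ π ∂M.proportionsPrior, ∀ d ℓ, 0 < π d ℓ ∧ π d ℓ ≤ 1 := by
  rw [ae_all_iff]
  intro d
  exact (Measure.quasiMeasurePreserving_eval (fun _ : Fin M.D => topicPrior M.α) d).ae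
    (ae_topicPrior M.K_pos)

theorem integrable_log_proportionsPrior (d : Fin M.D) (ℓ : Fin M.K) :
    Integrable (fun π : M.Proportions => Real.log (π d ℓ)) M.proportionsPrior :=
  integrable_comp_eval (μ := fun _ : Fin M.D => topicPrior M.α) (i := d)
    (f := fun x : Fin M.K → ℝ => Real.log (x ℓ)) (integrable_log_topicPrior M.K_pos M.α_pos ℓ)

theorem logForm_nonpos {N : Fin M.D → Fin M.K → ℝ} (hN : ∀ d ℓ, 0 ≤ N d ℓ) {π : M.Proportions}
    (hπ : ∀ d ℓ, 0 < π d ℓ ∧ π d ℓ ≤ 1) : logForm N π ≤ 0 :=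
  Finset.sum_nonpos fun d _ => Finset.sum_nonpos fun ℓ _ =>
    mul_nonpos_of_nonneg_of_nonpos (hN d ℓ) (Real.log_nonpos (hπ d ℓ).1.le (hπ d ℓ).2)

theorem ae_exp_logForm_le_one {N : Fin M.D → Fin M.K → ℝ} (hN : ∀ d ℓ, 0 ≤ N d ℓ) :
    ∀ᵐ π ∂M.proportionsPrior, ‖Real.exp (logForm N π)‖ ≤ 1 := by
  filter_upwards [ae_proportionsPrior M] with π hπ
  rw [Real.norm_eq_abs, Real.abs_exp]
  exact Real.exp_le_one_iff.2 (logForm_nonpos hN hπ)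

theorem integrable_exp_logForm {N : Fin M.D → Fin M.K → ℝ} (hN : ∀ d ℓ, 0 ≤ N d ℓ) :
    Integrable (fun π => Real.exp (logForm N π)) M.proportionsPrior :=
  Integrable.of_bound (by fun_prop) 1 (ae_exp_logForm_le_one hN)

theorem partition_pos {N : Fin M.D → Fin M.K → ℝ} (hN : ∀ d ℓ, 0 ≤ N d ℓ) : 0 < partition N :=
  integral_exp_pos (integrable_exp_logForm hN)

/-- Nonnegative exponents and proportions at most one bound the integrand by 1, so dominated
convergence applies. -/
theorem continuousOn_partition :
    ContinuousOn (partition (M := M)) {N | ∀ d ℓ, 0 ≤ N d ℓ} := by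
  refine continuousOn_of_dominated (bound := fun _ => 1) (fun N _ => by fun_prop)
    (fun N hN => ae_exp_logForm_le_one hN) (integrable_const 1) (ae_of_all _ fun π => ?_)
  unfold logForm
  fun_prop

theorem prod_prod_proportions {π : M.Proportions} (hπ : ∀ d ℓ, 0 < π d ℓ) (z : M.Topics) :
    ∏ d, ∏ i, ENNReal.ofReal (π d (z d i))
      = ENNReal.ofReal (Real.exp (logForm (fun d ℓ => (count z d ℓ : ℝ)) π)) := by
  simp_rw [← ENNReal.ofReal_prod_of_nonneg fun i (_ : i ∈ Finset.univ) => (hπ _ (z _ i)).le]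
  rw [← ENNReal.ofReal_prod_of_nonneg fun d _ => Finset.prod_nonneg fun i _ => (hπ _ _).le]
  congr 1
  rw [logForm, Real.exp_sum]
  refine Finset.prod_congr rfl fun d _ => ?_
  rw [← sum_comp_topics z d fun ℓ => Real.log (π d ℓ), Real.exp_sum]
  exact Finset.prod_congr rfl fun i _ => (Real.exp_log (hπ _ _)).symm

theorem likelihood_eq (X : M.Data) (p : M.Proportions × M.Topics) :
    M.likelihood X p = ENNReal.ofReal (prodWeight (M.wordLik X) p.2) := by
  rw [prodWeight, ENNReal.ofReal_prod_of_nonneg fun d _ =>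
    Finset.prod_nonneg fun i _ => wordLik_nonneg X d i _]
  refine Finset.prod_congr rfl fun d _ => ?_
  rw [ENNReal.ofReal_prod_of_nonneg fun i _ => wordLik_nonneg X d i _]
  rfl

/-- The prior of the topic proportions times the counting measure. -/
noncomputable def priorBase (M : LDAModel) : Measure (M.Proportions × M.Topics) :=
  M.proportionsPrior.prod Measure.count

instance (M : LDAModel) : IsFiniteMeasure M.priorBase := by
  unfold priorBase; infer_instance

theorem measurable_prod_dirichletPDF (M : LDAModel) :
    Measurable fun p : M.Proportions × M.Topics => ∏ d, dirichletPDF M.α (p.1 d) :=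
  Finset.measurable_prod _ fun d _ => (measurable_dirichletPDF M.α).comp
    ((measurable_pi_apply d).comp measurable_fst)

/-- Absorbing the Dirichlet densities into the base measure leaves a bounded posterior density, the
exponential of a linear form in `log π` times a function of `z`. -/
theorem priorBase_eq (M : LDAModel) :
    M.priorBase = M.baseMeasure.withDensity fun p => ∏ d, dirichletPDF M.α (p.1 d) := by
  have : IsFiniteMeasure ((simplexVolume M.K).withDensity (dirichletPDF M.α)) :=
    isFiniteMeasure_topicPrior_alpha M
  rw [priorBase, proportionsPrior]
  simp only [topicPrior]
  rw [pi_withDensity _ _ fun _ => measurable_dirichletPDF M.α, baseMeasure, prod_withDensity_left]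
  exact Finset.measurable_prod _ fun d _ => (measurable_dirichletPDF M.α).comp
    (measurable_pi_apply d)

theorem withDensity_priorBase {f : M.Proportions × M.Topics → ℝ≥0∞} (hf : Measurable f) :
    M.priorBase.withDensity f =
      M.baseMeasure.withDensity fun p => (∏ d, dirichletPDF M.α (p.1 d)) * f p := by
  rw [priorBase_eq, ← withDensity_mul _ (measurable_prod_dirichletPDF M) hf]
  rfl

theorem ae_baseMeasure (M : LDAModel) :
    ∀ᵐ p ∂M.baseMeasure, ∀ d, (∀ ℓ, 0 < p.1 d ℓ) ∧ dirichletPDF M.α (p.1 d) ≠ 0 := by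
  have h : ∀ᵐ π ∂Measure.pi fun _ : Fin M.D => simplexVolume M.K,
      ∀ d, (∀ ℓ, 0 < π d ℓ) ∧ dirichletPDF M.α (π d) ≠ 0 := by
    rw [ae_all_iff]
    intro d
    exact (Measure.quasiMeasurePreserving_eval (fun _ : Fin M.D => simplexVolume M.K) d).ae
      ((ae_pos_simplexVolume M.K_pos).and (ae_dirichletPDF_ne_zero M.K_pos M.α_pos))
  exact Measure.quasiMeasurePreserving_fst.ae h

/-- The unnormalized density of the posterior with respect to `priorBase`. -/
noncomputable def jointWeight (M : LDAModel) (X : M.Data) (p : M.Proportions × M.Topics) : ℝ :=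
  Real.exp (logForm (fun d ℓ => (count p.2 d ℓ : ℝ)) p.1) * prodWeight (M.wordLik X) p.2

theorem jointWeight_nonneg (X : M.Data) (p : M.Proportions × M.Topics) :
    0 ≤ M.jointWeight X p :=
  mul_nonneg (Real.exp_nonneg _) (prodWeight_nonneg (wordLik_nonneg X) _)

theorem measurable_jointWeight_left (X : M.Data) (z : M.Topics) :
    Measurable fun π : M.Proportions => M.jointWeight X (π, z) := by
  simp only [jointWeight]
  exact (measurable_logForm _).exp.mul_const _

theorem measurable_jointWeight (X : M.Data) :
    Measurable fun p : M.Proportions × M.Topics => M.jointWeight X p :=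
  measurable_from_prod_countable_left (measurable_jointWeight_left X)

theorem ae_prior_mul_likelihood (X : M.Data) :
    ∀ᵐ p ∂M.baseMeasure, M.priorDensity p * M.likelihood X p =
      (∏ d, dirichletPDF M.α (p.1 d)) * ENNReal.ofReal (M.jointWeight X p) := by
  filter_upwards [ae_baseMeasure M] with p hp
  rw [priorDensity, likelihood_eq, prod_prod_proportions (fun d => (hp d).1), mul_assoc,
    jointWeight, ENNReal.ofReal_mul (Real.exp_nonneg _)]

/-- The normalizing constant of the posterior. -/
noncomputable def evidenceSum (M : LDAModel) (X : M.Data) : ℝ :=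
  ∑ z : M.Topics, prodWeight (M.wordLik X) z * partition (M := M) fun d ℓ => (count z d ℓ : ℝ)

theorem partition_count_pos (z : M.Topics) :
    0 < partition (M := M) fun d ℓ => (count z d ℓ : ℝ) :=
  partition_pos fun _ _ => Nat.cast_nonneg _

/-- Assigning to each word a topic that can produce it gives a positive term. -/
theorem evidenceSum_pos (hη : ∀ r, ∃ ℓ, 0 < M.η ℓ r) (X : M.Data) : 0 < M.evidenceSum X := by
  choose t ht using hη
  refine Finset.sum_pos' (fun z _ => mul_nonneg (prodWeight_nonneg (wordLik_nonneg X) z)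
    (partition_count_pos z).le) ⟨fun d i => t (X d i), Finset.mem_univ _, ?_⟩
  exact mul_pos (Finset.prod_pos fun d _ => Finset.prod_pos fun i _ => ht _)
    (partition_count_pos _)

theorem lintegral_jointWeight (X : M.Data) (z : M.Topics) :
    ∫⁻ π, ENNReal.ofReal (M.jointWeight X (π, z)) ∂M.proportionsPrior =
      ENNReal.ofReal (prodWeight (M.wordLik X) z *
        partition (M := M) fun d ℓ => (count z d ℓ : ℝ)) := by
  rw [mul_comm, partition, ← integral_mul_const, ofReal_integral_eq_lintegral_ofReal]
  · rfl
  · exact (integrable_exp_logForm fun _ _ => Nat.cast_nonneg _).mul_const _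
  · exact ae_of_all _ fun π => jointWeight_nonneg X (π, z)

theorem evidence_eq (X : M.Data) : M.evidence X = ENNReal.ofReal (M.evidenceSum X) := by
  have hm : Measurable fun p => ENNReal.ofReal (M.jointWeight X p) :=
    (measurable_jointWeight X).ennreal_ofReal
  rw [evidence, lintegral_congr_ae (ae_prior_mul_likelihood X)]
  have h := lintegral_withDensity_eq_lintegral_mul M.baseMeasure
    (measurable_prod_dirichletPDF M) hm
  rw [← priorBase_eq, priorBase, lintegral_prod_symm _ hm.aemeasurable] at h
  refine h.symm.trans ?_
  rw [lintegral_count, tsum_fintype, evidenceSum, ENNReal.ofReal_sum_of_nonneg]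
  · exact Finset.sum_congr rfl fun z _ => lintegral_jointWeight X z
  · exact fun z _ => mul_nonneg (prodWeight_nonneg (wordLik_nonneg X) z)
      (partition_count_pos z).le

theorem posterior_eq (hη : ∀ r, ∃ ℓ, 0 < M.η ℓ r) (X : M.Data) :
    M.posterior X = M.priorBase.withDensity fun p =>
      ENNReal.ofReal (M.jointWeight X p / M.evidenceSum X) := by
  rw [withDensity_priorBase ((measurable_jointWeight X).div_const _).ennreal_ofReal, posterior]
  refine withDensity_congr_ae ?_
  filter_upwards [ae_prior_mul_likelihood X] with p hp
  rw [hp, evidence_eq, mul_div_assoc, ENNReal.ofReal_div_of_pos (evidenceSum_pos hη X)]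

/-- The probability of `z` under the collapsed posterior. -/
noncomputable def topicProb (M : LDAModel) (X : M.Data) (z : M.Topics) : ℝ :=
  prodWeight (M.wordLik X) z * partition (M := M) (fun d ℓ => (count z d ℓ : ℝ)) / M.evidenceSum X

theorem topicProb_nonneg (hη : ∀ r, ∃ ℓ, 0 < M.η ℓ r) (X : M.Data) (z : M.Topics) :
    0 ≤ M.topicProb X z :=
  div_nonneg (mul_nonneg (prodWeight_nonneg (wordLik_nonneg X) z) (partition_count_pos z).le)
    (evidenceSum_pos hη X).le

theorem sum_topicProb (hη : ∀ r, ∃ ℓ, 0 < M.η ℓ r) (X : M.Data) :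
    ∑ z, M.topicProb X z = 1 := by
  simp only [topicProb, ← Finset.sum_div]
  exact div_self (evidenceSum_pos hη X).ne'

theorem topicProb_ne_zero (hη : ∀ r, ∃ ℓ, 0 < M.η ℓ r) (X : M.Data) (z : M.Topics) :
    M.topicProb X z ≠ 0 ↔ prodWeight (M.wordLik X) z ≠ 0 := by
  simp [topicProb, (partition_count_pos z).ne', (evidenceSum_pos hη X).ne']

theorem collapsedPosterior_eq (hη : ∀ r, ∃ ℓ, 0 < M.η ℓ r) (X : M.Data) :
    M.collapsedPosterior X =
      (Measure.count : Measure M.Topics).withDensity fun z => ENNReal.ofReal (M.topicProb X z) := by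
  have hE := evidenceSum_pos hη X
  refine Measure.ext fun s hs => ?_
  rw [collapsedPosterior, Measure.map_apply measurable_snd hs, posterior_eq hη,
    withDensity_apply _ (measurable_snd hs), withDensity_apply _ hs, priorBase]
  have : Prod.snd ⁻¹' s = (Set.univ : Set M.Proportions) ×ˢ s := by ext; simp
  rw [this, ← Measure.prod_restrict, Measure.restrict_univ, lintegral_prod_symm _
    ((measurable_jointWeight X).div_const _).ennreal_ofReal.aemeasurable]
  refine lintegral_congr fun z => ?_
  simp_rw [ENNReal.ofReal_div_of_pos hE, topicProb, div_eq_mul_inv]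
  rw [lintegral_mul_const _ (measurable_jointWeight_left X z).ennreal_ofReal, lintegral_jointWeight, ← div_eq_mul_inv,
    ← div_eq_mul_inv, ENNReal.ofReal_div_of_pos hE]

theorem isProbabilityMeasure_collapsedPosterior (hη : ∀ r, ∃ ℓ, 0 < M.η ℓ r) (X : M.Data) :
    IsProbabilityMeasure (M.collapsedPosterior X) := by
  refine ⟨?_⟩
  rw [collapsedPosterior_eq hη, withDensity_apply _ MeasurableSet.univ, setLIntegral_univ,
    lintegral_count, tsum_fintype, ← ENNReal.ofReal_sum_of_nonneg fun z _ =>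
      topicProb_nonneg hη X z, sum_topicProb hη, ENNReal.ofReal_one]

theorem isProbabilityMeasure_posterior (hη : ∀ r, ∃ ℓ, 0 < M.η ℓ r) (X : M.Data) :
    IsProbabilityMeasure (M.posterior X) := by
  have := isProbabilityMeasure_collapsedPosterior hη X
  refine ⟨?_⟩
  rw [← measure_univ (μ := M.collapsedPosterior X), collapsedPosterior,
    Measure.map_apply measurable_snd MeasurableSet.univ, Set.preimage_univ]


/-! ### The reduced objective and its value at the pigeonholed counts. -/

theorem expCount_nonneg {ζ : M.Weights} (h : ∀ d i ℓ, 0 ≤ ζ d i ℓ) (d : Fin M.D) (ℓ : Fin M.K) :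
    0 ≤ expCount ζ d ℓ := Finset.sum_nonneg fun i _ => h d i ℓ

/-- The minimum over the laws of the topic proportions of the divergence to the posterior, as a
function of the mean-field parameters of the topics. -/
noncomputable def profile (M : LDAModel) (X : M.Data) (ζ : M.Weights) : ℝ :=
  M.topicEnergy X ζ + Real.log (M.evidenceSum X) - Real.log (partition (expCount ζ))

theorem continuousOn_profile (X : M.Data) : ContinuousOn (M.profile X) (M.feasible X) := by
  refine ContinuousOn.sub ((continuous_topicEnergy X).add continuous_const).continuousOn ?_
  refine ContinuousOn.log ?_ fun ζ hζ => (partition_pos (expCount_nonneg hζ.1)).ne'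
  refine continuousOn_partition.comp (f := expCount) ?_ fun ζ hζ => expCount_nonneg hζ.1
  unfold expCount
  fun_prop

/-- Some mean-field parameters achieve the logarithm of the number of counts. -/
theorem exists_profile_le (hη : ∀ r, ∃ ℓ, 0 < M.η ℓ r) (X : M.Data) :
    ∃ ζ ∈ M.feasible X, M.profile X ζ ≤ Real.log M.countSet.card := by
  classical
  have hE := evidenceSum_pos hη X
  have hcard : (0 : ℝ) < M.countSet.card := by exact_mod_cast one_le_card_countSet
  -- Pigeonhole: total posterior mass 1 is split among the fibres of `count`.
  obtain ⟨c, -, hc⟩ := Finset.exists_le_sum_fiber_of_maps_to_of_nsmul_le_sum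
    (s := (Finset.univ : Finset M.Topics)) (t := M.countSet) (f := count) (w := M.topicProb X)
    (b := (M.countSet.card : ℝ)⁻¹) (fun z _ => count_mem_countSet z)
    ⟨_, count_mem_countSet fun _ _ => ⟨0, M.K_pos⟩⟩
    (by rw [sum_topicProb hη, nsmul_eq_mul, mul_inv_cancel₀ hcard.ne'])
  set S := ∑ z with count z = c, prodWeight (M.wordLik X) z
  set W := partition (M := M) fun d ℓ => (c d ℓ : ℝ) with hW
  have hWpos : 0 < W := partition_pos fun _ _ => Nat.cast_nonneg _
  have hsum : ∑ z with count z = c, M.topicProb X z = S * W / M.evidenceSum X := by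
    rw [Finset.sum_mul, Finset.sum_div]
    refine Finset.sum_congr rfl fun z hz => ?_
    rw [topicProb, (Finset.mem_filter.1 hz).2]
  rw [hsum] at hc
  have hSpos : 0 < S := by
    have h1 : 0 < S * W / M.evidenceSum X := (inv_pos.2 hcard).trans_le hc
    have h2 : 0 < S * W := by
      by_contra! h
      exact absurd (div_nonpos_of_nonpos_of_nonneg h hE.le) (not_le.2 h1)
    exact pos_of_mul_pos_left h2 hWpos.le
  obtain ⟨ζ, hζ, hcount, hen⟩ := exists_feasible_of_count X c hSpos
  refine ⟨ζ, hζ, ?_⟩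
  -- Because the expected counts equal `c` exactly, the moment in `profile` is the same `W` as in
  -- the mass of the fibre.
  have h1 : expCount ζ = fun d ℓ => (c d ℓ : ℝ) := by
    funext d ℓ; exact hcount d ℓ
  have h2 := Real.log_le_log (inv_pos.2 hcard) hc
  rw [Real.log_inv, Real.log_div (by positivity) hE.ne', Real.log_mul hSpos.ne' hWpos.ne'] at h2
  rw [profile, h1, ← hW]
  linarith

theorem sum_prodWeight_mul_logForm {ζ : M.Weights} (h : ∀ d i, ∑ ℓ, ζ d i ℓ = 1)
    (π : M.Proportions) :
    ∑ z, prodWeight ζ z * logForm (fun d ℓ => (count z d ℓ : ℝ)) π = logForm (expCount ζ) π := by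
  simp_rw [logForm]
  have h1 : ∀ z : M.Topics, ∑ d, ∑ ℓ, (count z d ℓ : ℝ) * Real.log (π d ℓ)
      = ∑ d, ∑ i, Real.log (π d (z d i)) := fun z =>
    Finset.sum_congr rfl fun d _ => (sum_comp_topics z d fun ℓ => Real.log (π d ℓ)).symm
  simp_rw [h1]
  rw [sum_prodWeight_mul_sum h fun d _ ℓ => Real.log (π d ℓ)]
  refine Finset.sum_congr rfl fun d _ => ?_
  rw [Finset.sum_comm]
  exact Finset.sum_congr rfl fun ℓ _ => by rw [expCount, Finset.sum_mul]

theorem sum_prodWeight_mul_log_sub {X : M.Data} {ζ : M.Weights} (hζ : ζ ∈ M.feasible X) :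
    ∑ z, prodWeight ζ z * (Real.log (prodWeight ζ z) - Real.log (prodWeight (M.wordLik X) z))
      = M.topicEnergy X ζ := by
  rw [topicEnergy, ← sum_prodWeight_mul_sum hζ.2.1
    fun d i ℓ => Real.log (ζ d i ℓ) - Real.log (M.wordLik X d i ℓ)]
  refine Finset.sum_congr rfl fun z _ => ?_
  rcases eq_or_ne (prodWeight ζ z) 0 with h0 | h0
  · simp [h0]
  · rw [log_prodWeight h0, log_prodWeight (prodWeight_wordLik_ne_zero hζ h0)]
    simp_rw [← Finset.sum_sub_distrib]

/-- Each weight `ζ d i ℓ` is a marginal of the product law, so it vanishes when every `z` with `z d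
i = ℓ` has weight zero. -/
theorem mem_feasible_of_prodWeight {X : M.Data} {ζ : M.Weights} (h0 : ∀ d i ℓ, 0 ≤ ζ d i ℓ)
    (h1 : ∀ d i, ∑ ℓ, ζ d i ℓ = 1)
    (h : ∀ z, prodWeight (M.wordLik X) z = 0 → prodWeight ζ z = 0) : ζ ∈ M.feasible X := by
  refine ⟨h0, h1, fun d i ℓ hℓ => ?_⟩
  have := sum_prodWeight_mul h1 d i fun k => if k = ℓ then 1 else 0
  simp only [mul_ite, mul_one, mul_zero, Finset.sum_ite_eq', Finset.mem_univ, if_true] at this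
  rw [← this]
  refine Finset.sum_eq_zero fun z _ => ?_
  split_ifs with hz
  · refine h z ?_
    by_contra hne
    exact prodWeight_ne_zero.1 hne d i (hz ▸ hℓ)
  · rfl

/-! ### The mean-field families in terms of real weights. -/

/-- The product law of the topics with weights `ζ`. -/
noncomputable def topicLaw (ζ : M.Weights) : Measure M.Topics :=
  (Measure.count : Measure M.Topics).withDensity fun z => ENNReal.ofReal (prodWeight ζ z)

theorem topicLaw_singleton (ζ : M.Weights) (z : M.Topics) :
    topicLaw ζ {z} = ENNReal.ofReal (prodWeight ζ z) := by
  rw [topicLaw, withDensity_apply _ (measurableSet_singleton z)]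
  simp

theorem isProbabilityMeasure_topicLaw {ζ : M.Weights} (h0 : ∀ d i ℓ, 0 ≤ ζ d i ℓ)
    (h1 : ∀ d i, ∑ ℓ, ζ d i ℓ = 1) : IsProbabilityMeasure (topicLaw ζ) := by
  refine ⟨?_⟩
  rw [topicLaw, withDensity_apply _ MeasurableSet.univ, setLIntegral_univ,
    lintegral_count, tsum_fintype, ← ENNReal.ofReal_sum_of_nonneg fun z _ =>
      prodWeight_nonneg h0 z, sum_prodWeight h1, ENNReal.ofReal_one]

theorem integral_topicLaw {ζ : M.Weights} (h0 : ∀ d i ℓ, 0 ≤ ζ d i ℓ)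
    (h1 : ∀ d i, ∑ ℓ, ζ d i ℓ = 1) (f : M.Topics → ℝ) :
    ∫ z, f z ∂topicLaw ζ = ∑ z, prodWeight ζ z * f z := by
  have := isProbabilityMeasure_topicLaw h0 h1
  rw [integral_fintype .of_finite]
  refine Finset.sum_congr rfl fun z _ => ?_
  rw [measureReal_def, topicLaw_singleton, ENNReal.toReal_ofReal (prodWeight_nonneg h0 z),
    smul_eq_mul]

theorem prod_ofReal_eq {ζ : M.Weights} (h0 : ∀ d i ℓ, 0 ≤ ζ d i ℓ) (z : M.Topics) :
    ∏ d, ∏ i, ENNReal.ofReal (ζ d i (z d i)) = ENNReal.ofReal (prodWeight ζ z) := by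
  rw [prodWeight, ENNReal.ofReal_prod_of_nonneg fun d _ =>
    Finset.prod_nonneg fun i _ => h0 d i _]
  exact Finset.prod_congr rfl fun d _ =>
    (ENNReal.ofReal_prod_of_nonneg fun i _ => h0 d i _).symm

theorem exists_real_weights {ζ : (d : Fin M.D) → Fin (M.len d) → Fin M.K → ℝ≥0∞}
    (h : ∀ d i, ∑ ℓ, ζ d i ℓ = 1) :
    ∃ ζ' : M.Weights, (∀ d i ℓ, 0 ≤ ζ' d i ℓ) ∧ (∀ d i, ∑ ℓ, ζ' d i ℓ = 1) ∧
      ∀ d i ℓ, ζ d i ℓ = ENNReal.ofReal (ζ' d i ℓ) := by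
  have hfin : ∀ d i ℓ, ζ d i ℓ ≠ ∞ := fun d i ℓ => by
    have : ∑ ℓ, ζ d i ℓ ≠ ∞ := by simp [h]
    exact (ENNReal.sum_ne_top.1 this) ℓ (Finset.mem_univ _)
  refine ⟨fun d i ℓ => (ζ d i ℓ).toReal, fun _ _ _ => ENNReal.toReal_nonneg, fun d i => ?_,
    fun d i ℓ => (ENNReal.ofReal_toReal (hfin d i ℓ)).symm⟩
  rw [← ENNReal.toReal_sum fun ℓ _ => hfin d i ℓ, h, ENNReal.toReal_one]

theorem sum_ofReal_eq_one {ζ : M.Weights} (h0 : ∀ d i ℓ, 0 ≤ ζ d i ℓ)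
    (h1 : ∀ d i, ∑ ℓ, ζ d i ℓ = 1) (d : Fin M.D) (i : Fin (M.len d)) :
    ∑ ℓ, ENNReal.ofReal (ζ d i ℓ) = 1 := by
  rw [← ENNReal.ofReal_sum_of_nonneg fun ℓ _ => h0 d i ℓ, h1, ENNReal.ofReal_one]

theorem mem_collapsedMeanField_iff {Q : Measure M.Topics} :
    Q ∈ M.collapsedMeanField ↔ ∃ ζ : M.Weights, (∀ d i ℓ, 0 ≤ ζ d i ℓ) ∧
      (∀ d i, ∑ ℓ, ζ d i ℓ = 1) ∧ Q = topicLaw ζ := by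
  constructor
  · rintro ⟨ζ, h, rfl⟩
    obtain ⟨ζ', h0, h1, h2⟩ := exists_real_weights h
    refine ⟨ζ', h0, h1, ?_⟩
    simp_rw [topicLaw, ← prod_ofReal_eq h0, h2]
  · rintro ⟨ζ, h0, h1, rfl⟩
    refine ⟨fun d i ℓ => ENNReal.ofReal (ζ d i ℓ), sum_ofReal_eq_one h0 h1, ?_⟩
    simp_rw [topicLaw, ← prod_ofReal_eq h0]

/-- The law of the topic proportions with densities `ξ` with respect to the prior. -/
noncomputable def proportionsLaw (ξ : Fin M.D → (Fin M.K → ℝ) → ℝ≥0∞) : Measure M.Proportions :=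
  M.proportionsPrior.withDensity fun π => ∏ d, ξ d (π d)

theorem measurable_prod_eval {ξ : Fin M.D → (Fin M.K → ℝ) → ℝ≥0∞} (h : ∀ d, Measurable (ξ d)) :
    Measurable fun π : M.Proportions => ∏ d, ξ d (π d) :=
  Finset.measurable_prod _ fun d _ => (h d).comp (measurable_pi_apply d)

theorem isProbabilityMeasure_proportionsLaw {ξ : Fin M.D → (Fin M.K → ℝ) → ℝ≥0∞}
    (h : ∀ d, Measurable (ξ d)) (h1 : ∀ d, ∫⁻ x, ξ d x ∂topicPrior M.α = 1) :
    IsProbabilityMeasure (proportionsLaw ξ) := by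
  refine ⟨?_⟩
  rw [proportionsLaw, withDensity_apply _ MeasurableSet.univ, setLIntegral_univ,
    proportionsPrior, lintegral_pi_prod _ _ h]
  simp [h1]

theorem prod_law_eq {ξ : Fin M.D → (Fin M.K → ℝ) → ℝ≥0∞} (h : ∀ d, Measurable (ξ d))
    (ζ : M.Weights) : (proportionsLaw ξ).prod (topicLaw ζ) = M.priorBase.withDensity fun p =>
      (∏ d, ξ d (p.1 d)) * ENNReal.ofReal (prodWeight ζ p.2) := by
  have : SFinite (M.proportionsPrior.withDensity fun π => ∏ d, ξ d (π d)) := inferInstance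
  rw [proportionsLaw, topicLaw, prod_withDensity (measurable_prod_eval h) (by fun_prop), priorBase]

/-- Densities with respect to Lebesgue measure and to the prior differ by the Dirichlet density,
which is finite and almost everywhere nonzero. -/
theorem mem_fullMeanField_iff {P : Measure (M.Proportions × M.Topics)} :
    P ∈ M.fullMeanField ↔ ∃ (ξ : Fin M.D → (Fin M.K → ℝ) → ℝ≥0∞) (ζ : M.Weights),
      (∀ d, Measurable (ξ d)) ∧ (∀ d, ∫⁻ x, ξ d x ∂topicPrior M.α = 1) ∧
      (∀ d i ℓ, 0 ≤ ζ d i ℓ) ∧ (∀ d i, ∑ ℓ, ζ d i ℓ = 1) ∧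
      P = (proportionsLaw ξ).prod (topicLaw ζ) := by
  have hmd := measurable_dirichletPDF M.α
  have hw : ∀ {ξ : Fin M.D → (Fin M.K → ℝ) → ℝ≥0∞} (_ : ∀ d, Measurable (ξ d)) (ζ : M.Weights),
      Measurable fun p : M.Proportions × M.Topics =>
        (∏ d, ξ d (p.1 d)) * ENNReal.ofReal (prodWeight ζ p.2) := fun h ζ =>
    ((measurable_prod_eval h).comp measurable_fst).mul
      ((measurable_of_countable fun z => ENNReal.ofReal (prodWeight ζ z)).comp measurable_snd)
  constructor
  · rintro ⟨ξ, ζ, hξ, hζ, rfl⟩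
    obtain ⟨ζ', h0, h1, h2⟩ := exists_real_weights hζ
    have hξ' : ∀ d, Measurable fun x => ξ d x / dirichletPDF M.α x := fun d => (hξ d).1.div hmd
    refine ⟨fun d x => ξ d x / dirichletPDF M.α x, ζ', hξ', fun d => ?_, h0, h1, ?_⟩
    · rw [topicPrior, lintegral_withDensity_eq_lintegral_mul _ hmd (hξ' d), ← (hξ d).2]
      refine lintegral_congr_ae ?_
      filter_upwards [ae_dirichletPDF_ne_zero M.K_pos M.α_pos] with x hx
      exact ENNReal.mul_div_cancel hx ENNReal.ofReal_ne_top
    · rw [prod_law_eq hξ', withDensity_priorBase (hw hξ' ζ')]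
      refine withDensity_congr_ae ?_
      filter_upwards [ae_baseMeasure M] with p hp
      simp_rw [h2]
      rw [prod_ofReal_eq h0 p.2, ← mul_assoc, ← Finset.prod_mul_distrib]
      congr 1
      exact Finset.prod_congr rfl fun d _ =>
        (ENNReal.mul_div_cancel (hp d).2 ENNReal.ofReal_ne_top).symm
  · rintro ⟨ξ, ζ, hξ, hξ1, h0, h1, rfl⟩
    refine ⟨fun d x => dirichletPDF M.α x * ξ d x, fun d i ℓ => ENNReal.ofReal (ζ d i ℓ),
      fun d => ⟨hmd.mul (hξ d), ?_⟩, sum_ofReal_eq_one h0 h1, ?_⟩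
    · rw [← hξ1 d, topicPrior, lintegral_withDensity_eq_lintegral_mul _ hmd (hξ d)]
      rfl
    · rw [prod_law_eq hξ, withDensity_priorBase (hw hξ ζ)]
      refine withDensity_congr_ae (ae_of_all _ fun p => ?_)
      dsimp only
      rw [prod_ofReal_eq h0 p.2, ← mul_assoc, ← Finset.prod_mul_distrib]

theorem map_snd_mem_collapsedMeanField {P : Measure (M.Proportions × M.Topics)}
    (h : P ∈ M.fullMeanField) : P.map Prod.snd ∈ M.collapsedMeanField := by
  obtain ⟨ξ, ζ, hξ, hξ1, h0, h1, rfl⟩ := mem_fullMeanField_iff.1 h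
  have := isProbabilityMeasure_proportionsLaw hξ hξ1
  have := isProbabilityMeasure_topicLaw h0 h1
  refine mem_collapsedMeanField_iff.2 ⟨ζ, h0, h1, ?_⟩
  rw [← Measure.snd, Measure.snd_prod]

theorem topicLaw_absolutelyContinuous {X : M.Data} (hη : ∀ r, ∃ ℓ, 0 < M.η ℓ r) {ζ : M.Weights}
    (hζ : ζ ∈ M.feasible X) : topicLaw ζ ≪ M.collapsedPosterior X := by
  rw [collapsedPosterior_eq hη]
  refine withDensity_absolutelyContinuous_withDensity (by fun_prop) (ae_of_all _ fun z h => ?_)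
  rw [ENNReal.ofReal_eq_zero] at h
  have h' := le_antisymm h (topicProb_nonneg hη X z)
  by_contra hne
  have hq : prodWeight ζ z ≠ 0 := fun h0 => hne (by simp [h0])
  exact (topicProb_ne_zero hη X z).2 (prodWeight_wordLik_ne_zero hζ hq) h'

/-- Dirichlet moments are positive, so the collapsed posterior vanishes exactly where the likelihood
does. With the converse above, feasible weights are precisely those of absolutely continuous product
laws. -/
theorem mem_feasible_of_absolutelyContinuous {X : M.Data} (hη : ∀ r, ∃ ℓ, 0 < M.η ℓ r)
    {ζ : M.Weights} (h0 : ∀ d i ℓ, 0 ≤ ζ d i ℓ) (h1 : ∀ d i, ∑ ℓ, ζ d i ℓ = 1)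
    (h : topicLaw ζ ≪ M.collapsedPosterior X) : ζ ∈ M.feasible X := by
  refine mem_feasible_of_prodWeight h0 h1 fun z hz => ?_
  have hp : M.topicProb X z = 0 := by
    by_contra hne
    exact (topicProb_ne_zero hη X z).1 hne hz
  have h2 : M.collapsedPosterior X {z} = 0 := by
    rw [collapsedPosterior_eq hη, withDensity_apply _ (measurableSet_singleton z)]
    simp [hp]
  have h3 := h h2
  rw [topicLaw_singleton, ENNReal.ofReal_eq_zero] at h3
  exact le_antisymm h3 (prodWeight_nonneg h0 z)

/-- The divergence of the product law of the topics to the collapsed posterior. -/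
noncomputable def collapsedObjective (M : LDAModel) (X : M.Data) (ζ : M.Weights) : ℝ :=
  ∑ z, (prodWeight ζ z * Real.log (prodWeight ζ z) - prodWeight ζ z * Real.log (M.topicProb X z))

theorem continuous_collapsedObjective (X : M.Data) : Continuous (M.collapsedObjective X) := by
  have hc : ∀ z : M.Topics, Continuous fun ζ : M.Weights => prodWeight ζ z := fun z => by
    unfold prodWeight; fun_prop
  exact continuous_finsetSum _ fun z _ =>
    (Real.continuous_mul_log.comp (hc z)).sub ((hc z).mul continuous_const)

theorem klDiv_topicLaw (hη : ∀ r, ∃ ℓ, 0 < M.η ℓ r) {X : M.Data} {ζ : M.Weights}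
    (hζ : ζ ∈ M.feasible X) :
    klDiv (topicLaw ζ) (M.collapsedPosterior X) = ENNReal.ofReal (M.collapsedObjective X ζ) := by
  have := isProbabilityMeasure_topicLaw hζ.1 hζ.2.1
  have := isProbabilityMeasure_collapsedPosterior hη X
  have hac := topicLaw_absolutelyContinuous hη hζ
  rw [klDiv_of_ac_of_integrable hac .of_finite]
  simp only [probReal_univ, add_sub_cancel_right]
  congr 1
  have hllr : ∀ᵐ z ∂topicLaw ζ, llr (topicLaw ζ) (M.collapsedPosterior X) z
      = Real.log (prodWeight ζ z) - Real.log (M.topicProb X z) := by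
    have hfin : IsFiniteMeasure ((Measure.count : Measure M.Topics).withDensity
        fun z => ENNReal.ofReal (prodWeight ζ z)) :=
      (inferInstance : IsFiniteMeasure (topicLaw ζ))
    rw [collapsedPosterior_eq hη] at *
    filter_upwards [llr_withDensity_withDensity (B := (Measure.count : Measure M.Topics))
      (measurable_of_countable _) (measurable_of_countable _) hac] with z hz
    rw [topicLaw, hz.2.2, ENNReal.toReal_ofReal (prodWeight_nonneg hζ.1 z),
      ENNReal.toReal_ofReal (topicProb_nonneg hη X z)]
  rw [integral_congr_ae hllr, integral_topicLaw hζ.1 hζ.2.1, collapsedObjective]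
  simp_rw [mul_sub]


/-! ### Gibbs' variational principle for the proportions. -/

/-- The density of the optimal law of the topic proportions of the document `d`, given the expected
counts `N`. -/
noncomputable def optDensity (N : Fin M.D → Fin M.K → ℝ) (d : Fin M.D) (x : Fin M.K → ℝ) : ℝ≥0∞ :=
  ENNReal.ofReal (Real.exp (∑ ℓ, N d ℓ * Real.log (x ℓ)) /
    ∫ y : Fin M.K → ℝ, Real.exp (∑ ℓ, N d ℓ * Real.log (y ℓ)) ∂topicPrior M.α)

theorem measurable_sum_mul_log (a : Fin M.K → ℝ) :
    Measurable fun x : Fin M.K → ℝ => ∑ ℓ, a ℓ * Real.log (x ℓ) :=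
  Finset.measurable_sum _ fun ℓ _ =>
    (Real.measurable_log.comp (measurable_pi_apply ℓ)).const_mul _

theorem measurable_optDensity (N : Fin M.D → Fin M.K → ℝ) (d : Fin M.D) :
    Measurable (optDensity N d) :=
  ((measurable_sum_mul_log (N d)).exp.div_const _).ennreal_ofReal

theorem integrable_exp_sum_mul_log {a : Fin M.K → ℝ} (ha : ∀ ℓ, 0 ≤ a ℓ) :
    Integrable (fun x : Fin M.K → ℝ => Real.exp (∑ ℓ, a ℓ * Real.log (x ℓ))) (topicPrior M.α) := by
  refine Integrable.of_bound (measurable_sum_mul_log a).exp.aestronglyMeasurable 1 ?_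
  filter_upwards [ae_topicPrior M.K_pos] with x hx
  rw [Real.norm_eq_abs, Real.abs_exp]
  exact Real.exp_le_one_iff.2 (Finset.sum_nonpos fun ℓ _ =>
    mul_nonpos_of_nonneg_of_nonpos (ha ℓ) (Real.log_nonpos (hx ℓ).1.le (hx ℓ).2))

theorem lintegral_optDensity {N : Fin M.D → Fin M.K → ℝ} (hN : ∀ d ℓ, 0 ≤ N d ℓ) (d : Fin M.D) :
    ∫⁻ x, optDensity N d x ∂topicPrior M.α = 1 := by
  have hint := integrable_exp_sum_mul_log (hN d)
  have hpos := integral_exp_pos hint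
  simp only [optDensity]
  rw [← ofReal_integral_eq_lintegral_ofReal (hint.div_const _)
    (ae_of_all _ fun x => div_nonneg (Real.exp_nonneg _) hpos.le), integral_div,
    div_self hpos.ne', ENNReal.ofReal_one]

theorem partition_eq_prod (N : Fin M.D → Fin M.K → ℝ) :
    partition N = ∏ d, ∫ y : Fin M.K → ℝ, Real.exp (∑ ℓ, N d ℓ * Real.log (y ℓ))
      ∂topicPrior M.α := by
  simp only [partition, logForm, Real.exp_sum Finset.univ fun d => ∑ ℓ, N d ℓ * Real.log _]
  exact integral_fintype_prod_eq_prod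
    (μ := fun _ : Fin M.D => topicPrior M.α)
    (fun d (y : Fin M.K → ℝ) => Real.exp (∑ ℓ, N d ℓ * Real.log (y ℓ)))

theorem prod_optDensity {N : Fin M.D → Fin M.K → ℝ} (hN : ∀ d ℓ, 0 ≤ N d ℓ)
    (π : M.Proportions) :
    ∏ d, optDensity N d (π d) = ENNReal.ofReal (Real.exp (logForm N π) / partition N) := by
  rw [partition_eq_prod, logForm, Real.exp_sum, ← Finset.prod_div_distrib,
    ENNReal.ofReal_prod_of_nonneg]
  · rfl
  · exact fun d _ => div_nonneg (Real.exp_nonneg _)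
      (integral_exp_pos (integrable_exp_sum_mul_log (hN d))).le

theorem log_toReal_prod_optDensity {N : Fin M.D → Fin M.K → ℝ} (hN : ∀ d ℓ, 0 ≤ N d ℓ)
    (π : M.Proportions) :
    Real.log (∏ d, optDensity N d (π d)).toReal = logForm N π - Real.log (partition N) := by
  have h := partition_pos hN
  rw [prod_optDensity hN, ENNReal.toReal_ofReal (by positivity),
    Real.log_div (Real.exp_pos _).ne' h.ne', Real.log_exp]

theorem measurable_mul_prodWeight {f : M.Proportions → ℝ≥0∞} (hf : Measurable f)
    (ζ : M.Weights) : Measurable fun p : M.Proportions × M.Topics =>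
      f p.1 * ENNReal.ofReal (prodWeight ζ p.2) :=
  (hf.comp measurable_fst).mul
    ((measurable_of_countable fun z => ENNReal.ofReal (prodWeight ζ z)).comp measurable_snd)

theorem llr_prod_law (hη : ∀ r, ∃ ℓ, 0 < M.η ℓ r) {X : M.Data}
    {ξ : Fin M.D → (Fin M.K → ℝ) → ℝ≥0∞} (hξ : ∀ d, Measurable (ξ d))
    (hξ1 : ∀ d, ∫⁻ x, ξ d x ∂topicPrior M.α = 1)
    {ζ : M.Weights} (h0 : ∀ d i ℓ, 0 ≤ ζ d i ℓ) (h1 : ∀ d i, ∑ ℓ, ζ d i ℓ = 1)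
    (hac : (proportionsLaw ξ).prod (topicLaw ζ) ≪ M.posterior X) :
    ∀ᵐ p ∂(proportionsLaw ξ).prod (topicLaw ζ),
      llr ((proportionsLaw ξ).prod (topicLaw ζ)) (M.posterior X) p =
        Real.log (∏ d, ξ d (p.1 d)).toReal + Real.log (M.evidenceSum X)
        - logForm (fun d ℓ => (count p.2 d ℓ : ℝ)) p.1 +
        (Real.log (prodWeight ζ p.2) - Real.log (prodWeight (M.wordLik X) p.2)) := by
  have hE := evidenceSum_pos hη X
  have := isProbabilityMeasure_proportionsLaw hξ hξ1
  have := isProbabilityMeasure_topicLaw h0 h1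
  have i1 : IsFiniteMeasure (M.priorBase.withDensity fun p =>
      (∏ d, ξ d (p.1 d)) * ENNReal.ofReal (prodWeight ζ p.2)) := by
    rw [← prod_law_eq hξ]; infer_instance
  have i2 : IsFiniteMeasure (M.priorBase.withDensity fun p =>
      ENNReal.ofReal (M.jointWeight X p / M.evidenceSum X)) := by
    rw [← posterior_eq hη]
    have := isProbabilityMeasure_posterior hη X
    infer_instance
  rw [prod_law_eq hξ, posterior_eq hη] at *
  filter_upwards [llr_withDensity_withDensity
    (measurable_mul_prodWeight (measurable_prod_eval hξ) ζ)
    ((measurable_jointWeight X).div_const _).ennreal_ofReal hac] with p hp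
  obtain ⟨hp1, hp2, hp3⟩ := hp
  rw [hp3]
  rw [ENNReal.toReal_mul, ENNReal.toReal_ofReal (prodWeight_nonneg h0 _)] at *
  rw [ENNReal.toReal_ofReal (div_nonneg (jointWeight_nonneg X p) hE.le)] at *
  have hq : prodWeight ζ p.2 ≠ 0 := fun h => by simp [h] at hp1
  have hr : (∏ d, ξ d (p.1 d)).toReal ≠ 0 := fun h => by simp [h] at hp1
  have hh : prodWeight (M.wordLik X) p.2 ≠ 0 := fun h => by simp [jointWeight, h] at hp2
  rw [Real.log_mul hr hq, jointWeight, Real.log_div (mul_ne_zero (Real.exp_pos _).ne' hh) hE.ne',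
    Real.log_mul (Real.exp_pos _).ne' hh, Real.log_exp]
  ring

/-- Counts enter the log-likelihood ratio linearly, so averaging over topics replaces them by
expected counts. -/
theorem integral_topicLaw_llr {X : M.Data} {ζ : M.Weights} (hζ : ζ ∈ M.feasible X) (a : ℝ)
    (π : M.Proportions) :
    ∫ z, (a - logForm (fun d ℓ => (count z d ℓ : ℝ)) π +
        (Real.log (prodWeight ζ z) - Real.log (prodWeight (M.wordLik X) z))) ∂topicLaw ζ
      = a - logForm (expCount ζ) π + M.topicEnergy X ζ := by
  rw [integral_topicLaw hζ.1 hζ.2.1]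
  simp_rw [mul_add, Finset.sum_add_distrib]
  rw [sum_prodWeight_mul_log_sub hζ]
  simp_rw [mul_sub, Finset.sum_sub_distrib]
  rw [sum_prodWeight_mul_logForm hζ.2.1, ← Finset.sum_mul, sum_prodWeight hζ.2.1, one_mul]

/-- Once the topics are integrated out, the divergence exceeds `profile` by exactly the divergence
of the law of the proportions from the tilted prior, which is nonnegative. -/
theorem profile_le_klDiv (hη : ∀ r, ∃ ℓ, 0 < M.η ℓ r) {X : M.Data}
    {ξ : Fin M.D → (Fin M.K → ℝ) → ℝ≥0∞} (hξ : ∀ d, Measurable (ξ d))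
    (hξ1 : ∀ d, ∫⁻ x, ξ d x ∂topicPrior M.α = 1)
    {ζ : M.Weights} (h0 : ∀ d i ℓ, 0 ≤ ζ d i ℓ) (h1 : ∀ d i, ∑ ℓ, ζ d i ℓ = 1)
    (hfin : klDiv ((proportionsLaw ξ).prod (topicLaw ζ)) (M.posterior X) ≠ ∞) :
    ζ ∈ M.feasible X ∧ ENNReal.ofReal (M.profile X ζ) ≤
      klDiv ((proportionsLaw ξ).prod (topicLaw ζ)) (M.posterior X) := by
  have := isProbabilityMeasure_proportionsLaw hξ hξ1
  have := isProbabilityMeasure_topicLaw h0 h1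
  have := isProbabilityMeasure_posterior hη X
  obtain ⟨hac, hint⟩ := klDiv_ne_top_iff.1 hfin
  -- Finite divergence gives absolute continuity, which passes to the topic marginals.
  have hζ : ζ ∈ M.feasible X := by
    refine mem_feasible_of_absolutelyContinuous hη h0 h1 ?_
    have := hac.map measurable_snd
    rwa [← Measure.snd, Measure.snd_prod] at this
  refine ⟨hζ, ?_⟩
  rw [klDiv_of_ac_of_integrable hac hint]
  simp only [probReal_univ, add_sub_cancel_right]
  refine ENNReal.ofReal_le_ofReal ?_
  have hllr := llr_prod_law hη hξ hξ1 h0 h1 hac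
  rw [integral_congr_ae hllr]
  have hint' := (integrable_congr hllr).1 hint
  rw [integral_prod _ hint']
  have hinner := hint'.integral_prod_left
  simp only [integral_topicLaw_llr hζ] at hinner ⊢
  set N := expCount ζ
  have hN : ∀ d ℓ, 0 ≤ N d ℓ := expCount_nonneg h0
  have := isProbabilityMeasure_proportionsLaw (measurable_optDensity N) (lintegral_optDensity hN)
  have hacΞ : proportionsLaw ξ ≪ proportionsLaw (optDensity N) := by
    refine withDensity_absolutelyContinuous_withDensity
      (measurable_prod_eval (measurable_optDensity N)) (ae_of_all _ fun π h => ?_)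
    have hW := partition_pos hN
    rw [prod_optDensity hN, ENNReal.ofReal_eq_zero] at h
    exact absurd h (not_le.2 (by positivity))
  have i1 : IsFiniteMeasure (M.proportionsPrior.withDensity fun π => ∏ d, ξ d (π d)) :=
    (inferInstance : IsFiniteMeasure (proportionsLaw ξ))
  have i2 : IsFiniteMeasure (M.proportionsPrior.withDensity fun π => ∏ d, optDensity N d (π d)) :=
    (inferInstance : IsFiniteMeasure (proportionsLaw (optDensity N)))
  have hllrΞ : ∀ᵐ π ∂proportionsLaw ξ, llr (proportionsLaw ξ) (proportionsLaw (optDensity N)) π =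
      (Real.log (∏ d, ξ d (π d)).toReal + Real.log (M.evidenceSum X) - logForm N π
        + M.topicEnergy X ζ) - M.profile X ζ := by
    filter_upwards [llr_withDensity_withDensity (measurable_prod_eval hξ)
      (measurable_prod_eval (measurable_optDensity N)) hacΞ] with π hπ
    rw [proportionsLaw, proportionsLaw, hπ.2.2, log_toReal_prod_optDensity hN, profile]
    ring
  have hnonneg := integral_llr_add_sub_measure_univ_nonneg hacΞ
    ((integrable_congr hllrΞ).2 (hinner.sub (integrable_const _)))
  rw [integral_congr_ae hllrΞ, integral_sub hinner (integrable_const _)] at hnonneg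
  simp only [probReal_univ, add_sub_cancel_right, integral_const, one_smul] at hnonneg
  linarith

/-- The tilt is at most one, so integrability of `log π` passes from the prior to the optimal law.
-/
theorem proportionsLaw_optDensity_le {N : Fin M.D → Fin M.K → ℝ} (hN : ∀ d ℓ, 0 ≤ N d ℓ) :
    proportionsLaw (optDensity N) ≤ ENNReal.ofReal (1 / partition N) • M.proportionsPrior := by
  rw [← withDensity_const, proportionsLaw]
  refine withDensity_mono ?_
  filter_upwards [ae_exp_logForm_le_one hN] with π hπ
  rw [prod_optDensity hN]
  rw [Real.norm_eq_abs, Real.abs_exp] at hπ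
  exact ENNReal.ofReal_le_ofReal (div_le_div_of_nonneg_right hπ (partition_pos hN).le)

/-- For the tilted prior the terms in `log π` cancel after averaging over the topics, leaving the
constant `profile`. -/
theorem klDiv_optDensity (hη : ∀ r, ∃ ℓ, 0 < M.η ℓ r) {X : M.Data} {ζ : M.Weights}
    (hζ : ζ ∈ M.feasible X) :
    klDiv ((proportionsLaw (optDensity (expCount ζ))).prod (topicLaw ζ)) (M.posterior X)
      = ENNReal.ofReal (M.profile X ζ) := by
  set N := expCount ζ with hNdef
  have hN : ∀ d ℓ, 0 ≤ N d ℓ := expCount_nonneg hζ.1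
  have hE := evidenceSum_pos hη X
  have hm := measurable_optDensity N
  have h1 := lintegral_optDensity hN
  have := isProbabilityMeasure_proportionsLaw hm h1
  have := isProbabilityMeasure_topicLaw hζ.1 hζ.2.1
  have := isProbabilityMeasure_posterior hη X
  have hac : (proportionsLaw (optDensity N)).prod (topicLaw ζ) ≪ M.posterior X := by
    rw [prod_law_eq hm, posterior_eq hη]
    refine withDensity_absolutelyContinuous_withDensity
      ((measurable_jointWeight X).div_const _).ennreal_ofReal (ae_of_all _ fun p h => ?_)
    rw [ENNReal.ofReal_eq_zero] at h
    by_contra hne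
    have hq : prodWeight ζ p.2 ≠ 0 := fun h0 => hne (by simp [h0])
    have hh := (prodWeight_nonneg (wordLik_nonneg X) p.2).lt_of_ne'
      (prodWeight_wordLik_ne_zero hζ hq)
    exact absurd h (not_le.2 (div_pos (mul_pos (Real.exp_pos _) hh) hE))
  have hllr := llr_prod_law hη hm h1 hζ.1 hζ.2.1 hac
  have hlog : ∀ d ℓ, Integrable (fun π : M.Proportions => Real.log (π d ℓ))
      (proportionsLaw (optDensity N)) := fun d ℓ =>
    ((integrable_log_proportionsPrior d ℓ).smul_measure ENNReal.ofReal_ne_top).mono_measure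
      (proportionsLaw_optDensity_le hN)
  have hform : ∀ N' : Fin M.D → Fin M.K → ℝ,
      Integrable (logForm N') (proportionsLaw (optDensity N)) := fun N' => by
    unfold logForm
    exact integrable_finsetSum _ fun d _ => integrable_finsetSum _ fun ℓ _ =>
      (hlog d ℓ).const_mul _
  have hint' : Integrable (fun p : M.Proportions × M.Topics =>
        Real.log (∏ d, optDensity N d (p.1 d)).toReal + Real.log (M.evidenceSum X)
        - logForm (fun d ℓ => (count p.2 d ℓ : ℝ)) p.1 +
        (Real.log (prodWeight ζ p.2) - Real.log (prodWeight (M.wordLik X) p.2)))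
      ((proportionsLaw (optDensity N)).prod (topicLaw ζ)) := by
    simp only [log_toReal_prod_optDensity hN]
    refine Integrable.add (Integrable.sub (Integrable.add (Integrable.sub ?_ ?_) ?_) ?_) ?_
    · exact (hform N).comp_fst _
    · exact integrable_const _
    · exact integrable_const _
    · simp only [logForm]
      refine integrable_finsetSum _ fun d _ => integrable_finsetSum _ fun ℓ _ => ?_
      have := (hlog d ℓ).mul_prod (g := fun z : M.Topics => (count z d ℓ : ℝ)) (ν := topicLaw ζ)
        .of_finite
      simpa only [mul_comm] using this
    · exact (Integrable.of_finite (f := fun z : M.Topics =>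
        Real.log (prodWeight ζ z) - Real.log (prodWeight (M.wordLik X) z))).comp_snd _
  have hint := (integrable_congr hllr).2 hint'
  rw [klDiv_of_ac_of_integrable hac hint]
  simp only [probReal_univ, add_sub_cancel_right]
  congr 1
  rw [integral_congr_ae hllr, integral_prod _ hint']
  simp only [integral_topicLaw_llr hζ, log_toReal_prod_optDensity hN, ← hNdef]
  have : ∀ π : M.Proportions, logForm N π - Real.log (partition N) + Real.log (M.evidenceSum X)
      - logForm N π + M.topicEnergy X ζ = M.profile X ζ := fun π => by
    rw [profile]; ring
  simp [this]

/-! ### Existence of minimizers and the bounds. -/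

theorem exists_isFullVP (hη : ∀ r, ∃ ℓ, 0 < M.η ℓ r) (X : M.Data) :
    ∃ P, M.IsFullVP X P ∧
      klDiv P (M.posterior X) ≤ ENNReal.ofReal (Real.log M.countSet.card) := by
  obtain ⟨ζ₀, hζ₀, hle⟩ := exists_profile_le hη X
  obtain ⟨ζ, hζ, hmin⟩ := (isCompact_feasible X).exists_isMinOn ⟨ζ₀, hζ₀⟩ (continuousOn_profile X)
  refine ⟨(proportionsLaw (optDensity (expCount ζ))).prod (topicLaw ζ), ⟨?_, ?_⟩, ?_⟩
  · exact mem_fullMeanField_iff.2 ⟨_, ζ, measurable_optDensity _,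
      lintegral_optDensity (expCount_nonneg hζ.1), hζ.1, hζ.2.1, rfl⟩
  · intro P hP
    obtain ⟨ξ, ζ', hξ, hξ1, h0, h1, rfl⟩ := mem_fullMeanField_iff.1 hP
    change klDiv _ _ ≤ klDiv _ _
    rw [klDiv_optDensity hη hζ]
    by_cases hfin : klDiv ((proportionsLaw ξ).prod (topicLaw ζ')) (M.posterior X) = ∞
    · rw [hfin]; exact le_top
    · obtain ⟨hζ', hle'⟩ := profile_le_klDiv hη hξ hξ1 h0 h1 hfin
      exact (ENNReal.ofReal_le_ofReal (hmin hζ')).trans hle'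
  · rw [klDiv_optDensity hη hζ]
    exact ENNReal.ofReal_le_ofReal ((hmin hζ₀).trans hle)

/-- Non-feasible weights have infinite divergence, so it suffices to minimize over the compact
feasible set. -/
theorem exists_isCollapsedVP (hη : ∀ r, ∃ ℓ, 0 < M.η ℓ r) (X : M.Data) :
    ∃ Q, M.IsCollapsedVP X Q := by
  obtain ⟨ζ₀, hζ₀, -⟩ := exists_profile_le hη X
  obtain ⟨ζ, hζ, hmin⟩ := (isCompact_feasible X).exists_isMinOn ⟨ζ₀, hζ₀⟩
    (continuous_collapsedObjective X).continuousOn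
  refine ⟨topicLaw ζ, mem_collapsedMeanField_iff.2 ⟨ζ, hζ.1, hζ.2.1, rfl⟩, fun Q hQ => ?_⟩
  obtain ⟨ζ', h0, h1, rfl⟩ := mem_collapsedMeanField_iff.1 hQ
  change klDiv _ _ ≤ klDiv _ _
  rw [klDiv_topicLaw hη hζ]
  by_cases hac : topicLaw ζ' ≪ M.collapsedPosterior X
  · have hζ' := mem_feasible_of_absolutelyContinuous hη h0 h1 hac
    rw [klDiv_topicLaw hη hζ']
    exact ENNReal.ofReal_le_ofReal (hmin hζ')
  · rw [klDiv_of_not_ac hac]; exact le_top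

theorem klDiv_le_of_isFullVP (hη : ∀ r, ∃ ℓ, 0 < M.η ℓ r) {X : M.Data}
    {P : Measure (M.Proportions × M.Topics)} (hP : M.IsFullVP X P) :
    klDiv P (M.posterior X) ≤ ENNReal.ofReal (Real.log M.countSet.card) := by
  obtain ⟨P₀, hP₀, hle⟩ := exists_isFullVP hη X
  exact (hP.2 hP₀.1).trans hle

/-- The topic marginal of a full minimizer is a product law, and the data processing inequality
bounds its divergence. -/
theorem klDiv_le_of_isCollapsedVP (hη : ∀ r, ∃ ℓ, 0 < M.η ℓ r) {X : M.Data}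
    {Q : Measure M.Topics} (hQ : M.IsCollapsedVP X Q) :
    klDiv Q (M.collapsedPosterior X) ≤ ENNReal.ofReal (Real.log M.countSet.card) := by
  obtain ⟨P, hP, hle⟩ := exists_isFullVP hη X
  have := isProbabilityMeasure_posterior hη X
  obtain ⟨ξ, ζ, hξ, hξ1, h0, h1, rfl⟩ := mem_fullMeanField_iff.1 hP.1
  have := isProbabilityMeasure_proportionsLaw hξ hξ1
  have := isProbabilityMeasure_topicLaw h0 h1
  exact (hQ.2 (map_snd_mem_collapsedMeanField hP.1)).trans
    ((klDiv_map_le _ _ measurable_snd).trans hle)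

theorem iSup_div_le_rate {f : M.Data → ℝ≥0∞}
    (hf : ∀ X, f X ≤ ENNReal.ofReal (Real.log M.countSet.card)) :
    (⨆ X, f X) / (M.n : ℝ≥0∞) ≤ ENNReal.ofReal (3 * M.rate) := by
  have hn : (M.n : ℝ≥0∞) ≠ 0 := by exact_mod_cast M.n_pos.ne'
  rw [ENNReal.div_le_iff hn (ENNReal.natCast_ne_top _), mul_comm, ← ENNReal.ofReal_natCast,
    ← ENNReal.ofReal_mul (Nat.cast_nonneg _)]
  exact iSup_le fun X => (hf X).trans (ENNReal.ofReal_le_ofReal log_card_countSet_le)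

/-! ### Vanishing of the rate, and the theorem. -/

/-- With `x = D K / n`, the inequality `log y ≤ 2 √y` at `y = 1 / x + 2` bounds the rate by a
function of `x` that is continuous and zero at `x = 0`. -/
theorem rate_le_sqrt (M : LDAModel) :
    M.rate ≤ 2 * Real.sqrt ((M.D * M.K : ℝ) / M.n + 2 * ((M.D * M.K : ℝ) / M.n) ^ 2) := by
  have hn : (0 : ℝ) < M.n := by exact_mod_cast M.n_pos
  have hk : (0 : ℝ) < M.D * M.K := by exact_mod_cast M.DK_pos
  have hx : 0 < (M.D * M.K : ℝ) / M.n := div_pos hk hn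
  rw [rate]
  have hinv : (M.n : ℝ) / (M.D * M.K) = ((M.D * M.K : ℝ) / M.n)⁻¹ := (inv_div _ _).symm
  rw [hinv]
  set x := (M.D * M.K : ℝ) / M.n
  have h1 : Real.log (x⁻¹ + 2) ≤ 2 * Real.sqrt (x⁻¹ + 2) := by
    have hs : 0 < Real.sqrt (x⁻¹ + 2) := Real.sqrt_pos.2 (by positivity)
    have := Real.log_le_sub_one_of_pos hs
    rw [Real.log_sqrt (by positivity)] at this
    linarith
  have h2 : x * Real.sqrt (x⁻¹ + 2) = Real.sqrt (x + 2 * x ^ 2) := by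
    have h3 : x + 2 * x ^ 2 = x ^ 2 * (x⁻¹ + 2) := by field_simp
    rw [h3, Real.sqrt_mul (by positivity), Real.sqrt_sq hx.le]
  calc x * Real.log (x⁻¹ + 2) ≤ x * (2 * Real.sqrt (x⁻¹ + 2)) :=
        mul_le_mul_of_nonneg_left h1 hx.le
    _ = 2 * (x * Real.sqrt (x⁻¹ + 2)) := by ring
    _ = _ := by rw [h2]

theorem tendsto_ofReal_rate {M : ℕ → LDAModel}
    (h : Tendsto (fun t => ((M t).D * (M t).K : ℝ) / (M t).n) atTop (𝓝 0)) :
    Tendsto (fun t => ENNReal.ofReal (3 * (M t).rate)) atTop (𝓝 0) := by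
  have h1 : Tendsto (fun x : ℝ => ENNReal.ofReal (3 * (2 * Real.sqrt (x + 2 * x ^ 2))))
      (𝓝 0) (𝓝 0) := by
    have : Continuous fun x : ℝ => ENNReal.ofReal (3 * (2 * Real.sqrt (x + 2 * x ^ 2))) := by
      exact ENNReal.continuous_ofReal.comp (by fun_prop)
    simpa using this.tendsto 0
  exact tendsto_of_tendsto_of_tendsto_of_le_of_le tendsto_const_nhds (h1.comp h)
    (fun _ => zero_le) fun t => ENNReal.ofReal_le_ofReal
      (mul_le_mul_of_nonneg_left (rate_le_sqrt (M t)) (by norm_num))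

end LDAModel

theorem theorem1p1 (C₀ : ℝ) (hC₀ : 0 < C₀) :
    -- the variational posteriors exist
    (∀ M : LDAModel, M.Admissible C₀ → ∀ X : M.Data,
      (∃ P, M.IsFullVP X P) ∧ ∃ Q, M.IsCollapsedVP X Q) ∧
    -- the bounds (a) and (b), with a constant that depends only on `C₀`
    (∃ C : ℝ, 0 < C ∧ ∀ M : LDAModel, M.Admissible C₀ →
      (∀ P : M.Data → Measure (M.Proportions × M.Topics), (∀ X, M.IsFullVP X (P X)) →
        (⨆ X, InformationTheory.klDiv (P X) (M.posterior X)) / (M.n : ℝ≥0∞)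
          ≤ ENNReal.ofReal (C * M.rate)) ∧
      (∀ Q : M.Data → Measure M.Topics, (∀ X, M.IsCollapsedVP X (Q X)) →
        (⨆ X, InformationTheory.klDiv (Q X) (M.collapsedPosterior X)) / (M.n : ℝ≥0∞)
          ≤ ENNReal.ofReal (C * M.rate))) ∧
    -- consistency along every sequence of models with `D K = o(n)`
    (∀ M : ℕ → LDAModel, (∀ t, (M t).Admissible C₀) →
      Tendsto (fun t => ((M t).D * (M t).K : ℝ) / (M t).n) atTop (𝓝 0) →
      (∀ P : (t : ℕ) → (M t).Data → Measure ((M t).Proportions × (M t).Topics),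
        (∀ t X, (M t).IsFullVP X (P t X)) →
        Tendsto (fun t =>
          (⨆ X, InformationTheory.klDiv (P t X) ((M t).posterior X)) / ((M t).n : ℝ≥0∞))
          atTop (𝓝 0)) ∧
      (∀ Q : (t : ℕ) → (M t).Data → Measure (M t).Topics,
        (∀ t X, (M t).IsCollapsedVP X (Q t X)) →
        Tendsto (fun t =>
          (⨆ X, InformationTheory.klDiv (Q t X) ((M t).collapsedPosterior X)) / ((M t).n : ℝ≥0∞))
          atTop (𝓝 0))) := by
  have hfull : ∀ M : LDAModel, M.Admissible C₀ →
      ∀ P : M.Data → Measure (M.Proportions × M.Topics), (∀ X, M.IsFullVP X (P X)) →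
        (⨆ X, InformationTheory.klDiv (P X) (M.posterior X)) / (M.n : ℝ≥0∞)
          ≤ ENNReal.ofReal (3 * M.rate) := fun M hM P hP =>
    LDAModel.iSup_div_le_rate fun X => LDAModel.klDiv_le_of_isFullVP hM.1 (hP X)
  have hcoll : ∀ M : LDAModel, M.Admissible C₀ →
      ∀ Q : M.Data → Measure M.Topics, (∀ X, M.IsCollapsedVP X (Q X)) →
        (⨆ X, InformationTheory.klDiv (Q X) (M.collapsedPosterior X)) / (M.n : ℝ≥0∞)
          ≤ ENNReal.ofReal (3 * M.rate) := fun M hM Q hQ =>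
    LDAModel.iSup_div_le_rate fun X => LDAModel.klDiv_le_of_isCollapsedVP hM.1 (hQ X)
  refine ⟨fun M hM X => ⟨?_, LDAModel.exists_isCollapsedVP hM.1 X⟩,
    ⟨3, by norm_num, fun M hM => ⟨hfull M hM, hcoll M hM⟩⟩, fun M hM hlim =>
    ⟨fun P hP => ?_, fun Q hQ => ?_⟩⟩
  · obtain ⟨P, hP, -⟩ := LDAModel.exists_isFullVP hM.1 X
    exact ⟨P, hP⟩
  · exact tendsto_of_tendsto_of_tendsto_of_le_of_le tendsto_const_nhds
      (LDAModel.tendsto_ofReal_rate hlim) (fun _ => zero_le) fun t => hfull _ (hM t) _ (hP t)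
  · exact tendsto_of_tendsto_of_tendsto_of_le_of_le tendsto_const_nhds
      (LDAModel.tendsto_ofReal_rate hlim) (fun _ => zero_le) fun t => hcoll _ (hM t) _ (hQ t)
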